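/- Let $X$ be a Riemann surface of genus $1$ with a chosen origin, regarded as a compact connected one-dimensional complex Lie group, and let $N\ge 1$ be an integer. For a Riemann surface $Y$ of genus $1$, identified with a complex torus $\mathbb{C}/(\mathbb{Z}+\tau\mathbb{Z})$ with $\operatorname{Im}\tau>0$, put $\|\Delta\|(Y)=(\operatorname{Im}\tau)^6\,|\Delta(\tau)|$, where $\Delta(\tau)=q\prod_{k\ge 1}(1-q^k)^{24}$ and $q=e^{2\pi i\tau}$; this does not depend on the choice of $\tau$. For a finite subgroup $C$ of $X$ let $X^C=X/C$ be the quotient Riemann surface. Put $$e_N=N\prod_{p\mid N}\Bigl(1+\frac1p\Bigr),\qquad \lambda_N=\sum_{p\mid N,\ p^r\|N}\frac{p^r-1}{p^{r-1}(p^2-1)}\log p ,$$ where $p$ runs over the primes dividing $N$, and $p^r\| N$ means that $p^r\mid N$ and $p^{r+1}\nmid N$. Then $X$ has exactly $e_N$ cyclic subgroups of order $N$ (in particular finitely many), and $$\frac1{e_N}\sum_C\Bigl(\frac1{12}\log\|\Delta\|(X)-\frac1{12}\log\|\Delta\|(X^C)\Bigr)=\frac12\log N-\lambda_N ,$$ where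 the sum runs over the cyclic subgroups $C$ of $X$ of order $N$. -/

import Mathlib

open scoped Manifold ContDiff

/-- For a finite subgroup `C` of a Hausdorff topological group `X`, the projection `X → X ⧸ C` is a
local homeomorphism. -/
theorem isLocalHomeomorph_mk_of_finite {X : Type*} [AddCommGroup X] [TopologicalSpace X]
    [IsTopologicalAddGroup X] [T2Space X] (C : AddSubgroup X) [Finite C] :
    IsLocalHomeomorph (QuotientAddGroup.mk : X → X ⧸ C) := by
  have hC : IsDiscrete (C : Set X) := ⟨by
    have : Finite (C : Set X) := ‹Finite C›
    infer_instance⟩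
  exact (AddSubgroup.isAddQuotientCoveringMap_of_comm C hC).isCoveringMap.isLocalHomeomorph

/-- The complex structure on the quotient `X ⧸ C` of a one-dimensional complex Lie group by a finite
subgroup: the charts are the local inverses of the projection `X → X ⧸ C` followed by the charts
of `X`. -/
noncomputable instance quotientChartedSpace {X : Type*} [AddCommGroup X] [TopologicalSpace X]
    [T2Space X] [ChartedSpace ℂ X] [LieAddGroup 𝓘(ℂ) ω X] (C : AddSubgroup X) [Finite C] :
    ChartedSpace ℂ (X ⧸ C) :=
  haveI : IsTopologicalAddGroup X := topologicalAddGroup_of_lieAddGroup 𝓘(ℂ) ω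
  (isLocalHomeomorph_mk_of_finite C).chartedSpace Quotient.mk_surjective

/-- The transition maps of the quotient `X ⧸ C` are analytic, so that it is a Riemann surface. -/
instance quotientIsManifold {X : Type*} [AddCommGroup X] [TopologicalSpace X]
    [T2Space X] [ChartedSpace ℂ X] [LieAddGroup 𝓘(ℂ) ω X] (C : AddSubgroup X) [Finite C] :
    IsManifold 𝓘(ℂ) ω (X ⧸ C) := by
  have : IsTopologicalAddGroup X := topologicalAddGroup_of_lieAddGroup 𝓘(ℂ) ω
  have hf := isLocalHomeomorph_mk_of_finite C
  refine isManifold_of_contDiffOn 𝓘(ℂ) ω (X ⧸ C) ?_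
  rintro _ _ ⟨q, rfl⟩ ⟨q', rfl⟩
  generalize (QuotientAddGroup.mk_surjective (s := C)).hasRightInverse.choose q = a
  generalize (QuotientAddGroup.mk_surjective (s := C)).hasRightInverse.choose q' = b
  intro x hx
  simp only [OpenPartialHomeomorph.trans_symm_eq_symm_trans_symm, mfld_simps,
    IsLocalHomeomorph.localInverseAt_symm] at hx
  apply ContDiffAt.contDiffWithinAt
  set u := chartAt ℂ a with hu
  set v := chartAt ℂ b with hv
  set L := hf.localInverseAt b with hL
  obtain ⟨⟨hx1, hx2⟩, hx3, hx4⟩ := hx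
  have hxu : u.symm x ∈ u.source := u.map_target hx1
  set y := u.symm x with hy
  set c : X := L (y : X ⧸ C) - y with hc
  have hmk : ((L (y : X ⧸ C) : X) : X ⧸ C) = y := hf.apply_localInverseAt_of_mem hx3
  have hcC : c ∈ C := by
    rw [← QuotientAddGroup.eq_zero_iff, hc, QuotientAddGroup.mk_sub, hmk, sub_self]
  have hyc : y + c = L (y : X ⧸ C) := by rw [hc]; abel
  have hsm : ContMDiffAt 𝓘(ℂ) 𝓘(ℂ) ω (fun z => v (u.symm z + c)) x := by
    have h1 : ContMDiffAt 𝓘(ℂ) 𝓘(ℂ) ω u.symm x :=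
      contMDiffAt_symm_of_mem_maximalAtlas (IsManifold.chart_mem_maximalAtlas a) hx1
    have h2 : ContMDiffAt 𝓘(ℂ) 𝓘(ℂ) ω (fun z => u.symm z + c) x := h1.add contMDiffAt_const
    have h3 : ContMDiffAt 𝓘(ℂ) 𝓘(ℂ) ω v (u.symm x + c) :=
      contMDiffAt_of_mem_maximalAtlas (IsManifold.chart_mem_maximalAtlas b) (by
        rw [← hy, hyc]; exact hx4)
    exact ContMDiffAt.comp x h3 h2
  refine (hsm.contDiffAt).congr_of_eventuallyEq ?_
  have hcont : ContinuousAt u.symm x := u.symm.continuousAt hx1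
  have e1 : ∀ᶠ z in nhds x, u.symm z + c ∈ L.target :=
    (hcont.add continuousAt_const).eventually_mem (L.open_target.mem_nhds (by
      change y + c ∈ L.target
      rw [hyc]; exact L.map_source hx3))
  have e2 : ∀ᶠ z in nhds x, ((u.symm z : X) : X ⧸ C) ∈ L.source :=
    (hf.continuous.continuousAt.comp hcont).eventually_mem (L.open_source.mem_nhds hx3)
  filter_upwards [e1, e2] with z hz1 hz2
  simp only [OpenPartialHomeomorph.trans_symm_eq_symm_trans_symm, mfld_simps,
    IsLocalHomeomorph.localInverseAt_symm]
  congr 1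
  refine hf.injOn_localInverseAt_target (L.map_source hz2) hz1 ?_
  rw [hf.apply_localInverseAt_of_mem hz2, QuotientAddGroup.mk_add,
    (QuotientAddGroup.eq_zero_iff c).2 hcC, add_zero]

/-- The holomorphic map `π : ℂ → X` identifies the Riemann surface `X` with the complex torus
`ℂ / (ℤ + τ ℤ)`: it is surjective, and two points have the same image exactly when they differ by
an element of `ℤ + τ ℤ`. -/
structure IsTorusParametrization {X : Type*} [TopologicalSpace X] [ChartedSpace ℂ X]
    (τ : UpperHalfPlane) (π : ℂ → X) : Prop where
  holomorphic : MDifferentiable 𝓘(ℂ) 𝓘(ℂ) π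
  surjective : Function.Surjective π
  eq_iff : ∀ z w : ℂ, π z = π w ↔ ∃ m n : ℤ, z - w = m + n * (τ : ℂ)

open Classical in
/-- The invariant `‖Δ‖(X) = (Im τ) ^ 6 * |Δ(τ)|` of a Riemann surface `X` that can be identified
with a complex torus `ℂ / (ℤ + τ ℤ)`. The value does not depend on the choice of `τ`; here
`ModularForm.discriminant τ` is `Δ(τ) = η(τ) ^ 24`. -/
noncomputable def normDelta (X : Type*) [TopologicalSpace X] [ChartedSpace ℂ X]
    [IsManifold 𝓘(ℂ) ω X] : ℝ :=
  if h : ∃ τ : UpperHalfPlane, ∃ π : ℂ → X, IsTorusParametrization τ π then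
    h.choose.im ^ 6 * ‖ModularForm.discriminant h.choose‖
  else 0

/-- The set of cyclic subgroups of order `N`. -/
def CyclicSubgroups (X : Type*) [AddCommGroup X] (N : ℕ) : Type _ :=
  {C : AddSubgroup X // IsAddCyclic C ∧ Nat.card C = N}

instance finite_cyclicSubgroup {X : Type*} [AddCommGroup X] {N : ℕ} [NeZero N]
    (C : CyclicSubgroups X N) : Finite C.1 :=
  Nat.finite_of_card_ne_zero (C.2.2.trans_ne (NeZero.ne N))

/-- The number `e_N = N ∏_{p ∣ N} (1 + 1 / p)`. -/
noncomputable def eN (N : ℕ) : ℝ :=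
  N * ∏ p ∈ N.primeFactors, (1 + 1 / (p : ℝ))

/-- The number `λ_N`, the sum over the primes `p ∣ N` of `(p ^ r - 1) / (p ^ (r - 1) (p ^ 2 - 1)) log p`,
where `p ^ r` is the exact power of `p` that divides `N` (so that `1 ≤ r`). -/
noncomputable def lambdaN (N : ℕ) : ℝ :=
  ∑ p ∈ N.primeFactors,
    ((p : ℝ) ^ N.factorization p - 1) /
      ((p : ℝ) ^ (N.factorization p - 1) * ((p : ℝ) ^ 2 - 1)) * Real.log p

/-! The exponential map writes `X` as `ℂ / L`. Cyclic subgroups `C` of order `N` then correspond to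
overlattices `L' ⊇ L` with `L' / L` cyclic of order `N`, and `X / C = ℂ / L'`. The claim thus
concerns the homothety-invariant function `f = log ‖Δ‖` on lattices.

For a prime `p` the product formula `η(pz) ∏ η((z + j) / p) = η(z) ^ (p + 1)`, valid up to a
constant of modulus one, gives `∑ f(L') = (p + 1) f(L) + 6 (1 - p) log p` over the `p + 1`
overlattices of index `p` (`finsum_log_latticeDelta_prime`).

For `N = p M`, group the `L'` by the intermediate lattice `L₁ = L + p L'`, which is cyclic of order
`M` over `L`. If `p ∤ M`, the fibre over `L₁` consists of all index-`p` overlattices of `L₁`. If `p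
∣ M`, exactly one is missing, and it is homothetic to `L + p L₁` (`finsum_cyclicFiber`). This yields
a recursion in `N` that also involves `M / p`, solved by `eN N * (f L + heckeConst N)` with
`heckeConst N = -6 log N + 12 λ_N`. The same recursion for `f = 1` counts the overlattices
(`finsum_cyclicOver_of_card`).

It remains to identify `normDelta` with the lattice function. A torus parametrization lifts to an
entire function with doubly periodic derivative, hence an affine map, so its lattice is a multiple
of `L` (`IsUniformization.normDelta_eq`). The uniformization of `X` is built by integrating the
invariant differential of the local group law (`exists_local_log`) and extending its inverse to `ℂ`.
-/

/-! ### The Euler product and its Hecke relation. -/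

/-- The Euler product `∏ (1 - x ^ (n + 1))`. -/
noncomputable def eulerProd (x : ℂ) : ℂ := ∏' n : ℕ, (1 - x ^ (n + 1))

/-- A product over the positive multiples of `p`, as a product over all positive integers. -/
theorem hasProd_multiples {p : ℕ} (hp : 0 < p) {g : ℕ → ℂ} {a : ℂ}
    (h : HasProd (fun n : ℕ => g (n + 1)) a) :
    HasProd (fun n : ℕ => if p ∣ n + 1 then g ((n + 1) / p) else 1) a := by
  -- Index `n` stands for the integer `n + 1`, so the multiples of `p` sit at the indices `p * (m +
  -- 1) - 1`.
  have hinj : Function.Injective (fun m : ℕ => p * (m + 1) - 1) := by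
    intro a b hab
    have ha : 0 < p * (a + 1) := by positivity
    have hb : 0 < p * (b + 1) := by positivity
    have : p * (a + 1) = p * (b + 1) := by simp only at hab; omega
    have := Nat.eq_of_mul_eq_mul_left hp this
    omega
  have hs (m : ℕ) : p * (m + 1) - 1 + 1 = p * (m + 1) := Nat.sub_add_cancel (by nlinarith)
  rw [← hinj.hasProd_iff]
  · convert! h using 1
    funext m
    simp [hs, Nat.mul_div_cancel_left _ hp]
  · intro n hn
    rw [if_neg]
    rintro ⟨k, hk⟩
    refine hn ⟨k - 1, ?_⟩
    have : k ≠ 0 := by rintro rfl; simp at hk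
    have hk1 : k - 1 + 1 = k := by omega
    simp only [hk1, ← hk]
    omega

theorem hasProd_eulerProd {x : ℂ} (hx : ‖x‖ < 1) :
    HasProd (fun n : ℕ => 1 - x ^ (n + 1)) (eulerProd x) :=
  (ModularForm.multipliable_one_sub_pow hx).hasProd

theorem prod_one_sub_rootOfUnity_mul {ζ : ℂ} {p : ℕ} (hζ : IsPrimitiveRoot ζ p) (hp : 0 < p)
    (y : ℂ) : ∏ j ∈ Finset.range p, (1 - ζ ^ j * y) = 1 - y ^ p := by
  have h := hζ.pow_sub_pow_eq_prod_sub_mul 1 y hp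
  rw [one_pow] at h
  rw [h]
  refine Finset.prod_bij (fun j _ => ζ ^ j) ?_ ?_ ?_ (fun _ _ => rfl)
  · intro j _
    rw [Polynomial.mem_nthRootsFinset hp, ← pow_mul, mul_comm, pow_mul, hζ.pow_eq_one, one_pow]
  · intro i hi j hj hij
    exact hζ.pow_inj (Finset.mem_range.1 hi) (Finset.mem_range.1 hj) hij
  · intro b hb
    have : NeZero p := ⟨hp.ne'⟩
    obtain ⟨i, hi, h⟩ := hζ.eq_pow_of_pow_eq_one ((Polynomial.mem_nthRootsFinset hp _).1 hb)
    exact ⟨i, Finset.mem_range.2 hi, h⟩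

/-- The Hecke relation at a prime `p` for the Euler product. -/
theorem eulerProd_hecke {ζ : ℂ} {p : ℕ} (hp : p.Prime) (hζ : IsPrimitiveRoot ζ p) {x : ℂ}
    (hx : ‖x‖ < 1) :
    eulerProd (x ^ p ^ 2) * ∏ j ∈ Finset.range p, eulerProd (ζ ^ j * x) =
      eulerProd (x ^ p) ^ (p + 1) := by
  have hp0 := hp.pos
  have hxp : ‖x ^ p‖ < 1 := by
    rw [norm_pow]; exact pow_lt_one₀ (norm_nonneg _) hx hp0.ne'
  have hxpp : ‖x ^ p ^ 2‖ < 1 := by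
    rw [norm_pow]; exact pow_lt_one₀ (norm_nonneg _) hx (by positivity)
  have h1 : HasProd (fun n : ℕ => if p ∣ n + 1 then 1 - (x ^ p ^ 2) ^ ((n + 1) / p) else 1)
      (eulerProd (x ^ p ^ 2)) :=
    hasProd_multiples hp0 (g := fun n => 1 - (x ^ p ^ 2) ^ n) (hasProd_eulerProd hxpp)
  have h2 : HasProd (fun n : ℕ => ∏ j ∈ Finset.range p, (1 - (ζ ^ j * x) ^ (n + 1)))
      (∏ j ∈ Finset.range p, eulerProd (ζ ^ j * x)) := by
    refine hasProd_prod fun j _ => hasProd_eulerProd ?_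
    rw [norm_mul, norm_pow, hζ.norm'_eq_one hp0.ne', one_pow, one_mul]
    exact hx
  have h3 : HasProd (fun n : ℕ => if p ∣ n + 1 then (1 - (x ^ p) ^ ((n + 1) / p)) ^ p else 1)
      (eulerProd (x ^ p) ^ p) := by
    refine hasProd_multiples hp0 (g := fun n => (1 - (x ^ p) ^ n) ^ p) ?_
    have := hasProd_prod (s := Finset.range p) fun _ _ => hasProd_eulerProd hxp
    simpa only [Finset.prod_const, Finset.card_range] using this
  have h4 := hasProd_eulerProd hxp
  rw [pow_succ]
  -- Compare factor by factor: if `p ∣ n + 1` the root of unity disappears and the `p` factors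
  -- coincide; otherwise `ζ ^ (n + 1)` is again primitive and they multiply to `1 - x ^ (p (n +
  -- 1))`.
  refine (h1.mul h2).unique ((h3.mul h4).congr_fun fun n => ?_)
  by_cases hn : p ∣ n + 1
  · obtain ⟨k, hk⟩ := hn
    have e1 : ∀ j, (1 - (ζ ^ j * x) ^ (n + 1)) = 1 - (x ^ p) ^ k := by
      intro j
      rw [mul_pow, ← pow_mul, hk, mul_left_comm, pow_mul ζ, hζ.pow_eq_one, one_pow, one_mul,
        pow_mul]
    have e2 : (x ^ p ^ 2) ^ k = (x ^ p) ^ (n + 1) := by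
      rw [hk, ← pow_mul, ← pow_mul]
      congr 1
      ring
    simp only [e1, Finset.prod_const, Finset.card_range]
    rw [hk, Nat.mul_div_cancel_left _ hp0, e2, hk, mul_comm, if_pos (dvd_mul_right p k),
      if_pos (dvd_mul_right p k)]
  · simp only [if_neg hn, one_mul]
    have hc : (n + 1).Coprime p := ((Nat.Prime.coprime_iff_not_dvd hp).2 hn).symm
    have := prod_one_sub_rootOfUnity_mul (hζ.pow_of_coprime _ hc) hp0 (x ^ (n + 1))
    rw [← pow_mul, mul_comm p, pow_mul, ← this]
    refine Finset.prod_congr rfl fun j _ => ?_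
    rw [mul_pow, ← pow_mul, ← pow_mul, mul_comm j]

/-! ### `‖Δ‖` on the upper half-plane. -/

/-- The function `‖Δ‖` as a function of the period ratio. -/
noncomputable def periodDelta (z : ℂ) : ℝ := z.im ^ 6 * ‖ModularForm.eta z ^ 24‖

theorem norm_eta (z : ℂ) : ‖ModularForm.eta z‖ =
    Real.exp (-(2 * Real.pi * z.im) / 24) * ‖eulerProd (Complex.exp (2 * Real.pi * Complex.I * z))‖ := by
  have : ModularForm.eta z = Function.Periodic.qParam 24 z *
      eulerProd (Complex.exp (2 * Real.pi * Complex.I * z)) := by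
    simp [ModularForm.eta, eulerProd, ModularForm.eta_q_eq_pow]
  rw [this, norm_mul, Function.Periodic.norm_qParam]
  congr 2
  ring

/-- This is `eulerProd_hecke` at `x = exp (2πi z / p)`. The exponential prefactors match because `p
+ p · (1 / p) = p + 1`; norms remove the root of unity left by the shifts `j`. -/
theorem norm_eta_hecke {p : ℕ} (hp : p.Prime) {z : ℂ} (hz : 0 < z.im) :
    ‖ModularForm.eta (p * z)‖ * ∏ j ∈ Finset.range p, ‖ModularForm.eta ((z + j) / p)‖ =
      ‖ModularForm.eta z‖ ^ (p + 1) := by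
  have hp0 : (p : ℂ) ≠ 0 := by exact_mod_cast hp.ne_zero
  have hpr : (p : ℝ) ≠ 0 := by exact_mod_cast hp.ne_zero
  set x : ℂ := Complex.exp (2 * Real.pi * Complex.I * (z / p)) with hx
  have him (j : ℕ) : ((z + j) / p).im = z.im / p := by
    rw [Complex.div_natCast_im]; simp
  have hx1 : ‖x‖ < 1 := by
    have : 0 < (z / p).im := by
      rw [Complex.div_natCast_im]
      have := hp.pos
      positivity
    exact UpperHalfPlane.norm_exp_two_pi_I_lt_one ⟨z / p, this⟩
  have hζ := Complex.isPrimitiveRoot_exp p hp.ne_zero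
  have h := congrArg norm (eulerProd_hecke hp hζ hx1)
  rw [norm_mul, norm_prod, norm_pow] at h
  have e1 : x ^ p ^ 2 = Complex.exp (2 * Real.pi * Complex.I * (p * z)) := by
    rw [hx, ← Complex.exp_nat_mul]
    congr 1
    push_cast
    field_simp
  have e2 : x ^ p = Complex.exp (2 * Real.pi * Complex.I * z) := by
    rw [hx, ← Complex.exp_nat_mul]
    congr 1
    field_simp
  have e3 (j : ℕ) : Complex.exp (2 * Real.pi * Complex.I / p) ^ j * x =
      Complex.exp (2 * Real.pi * Complex.I * ((z + j) / p)) := by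
    rw [hx, ← Complex.exp_nat_mul, ← Complex.exp_add]
    congr 1
    field_simp
    ring
  simp only [e1, e2, e3] at h
  simp only [norm_eta, him, Finset.prod_mul_distrib, mul_pow]
  rw [mul_mul_mul_comm, h]
  congr 1
  rw [Finset.prod_const, Finset.card_range, ← Real.exp_nat_mul, ← Real.exp_nat_mul, ← Real.exp_add]
  congr 1
  simp only [Complex.mul_im, Complex.natCast_re, Complex.natCast_im]
  field_simp
  push_cast
  ring

/-- The Hecke relation at a prime `p` for `log ‖Δ‖`. -/
theorem log_periodDelta_hecke {p : ℕ} (hp : p.Prime) {z : ℂ} (hz : 0 < z.im) :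
    Real.log (periodDelta (p * z)) + ∑ j ∈ Finset.range p, Real.log (periodDelta ((z + j) / p)) =
      (p + 1) * Real.log (periodDelta z) + 6 * (1 - p) * Real.log p := by
  have hpr : 0 < (p : ℝ) := by exact_mod_cast hp.pos
  have him (j : ℕ) : ((z + j) / p).im = z.im / p := by
    rw [Complex.div_natCast_im]; simp
  have himp : ((p : ℂ) * z).im = p * z.im := by simp
  have hlog (w : ℂ) (hw : 0 < w.im) : Real.log (periodDelta w) =
      6 * Real.log w.im + 24 * Real.log ‖ModularForm.eta w‖ := by
    have := norm_pos_iff.2 (ModularForm.eta_ne_zero (z := w) hw)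
    rw [periodDelta, norm_pow, Real.log_mul (by positivity) (by positivity), Real.log_pow,
      Real.log_pow]
    norm_num
  have hj (j : ℕ) : 0 < ((z + j) / p).im := by rw [him]; positivity
  have hpz : 0 < ((p : ℂ) * z).im := by rw [himp]; positivity
  have h := congrArg Real.log (norm_eta_hecke hp hz)
  have hne {w : ℂ} (hw : 0 < w.im) : ‖ModularForm.eta w‖ ≠ 0 :=
    norm_ne_zero_iff.2 (ModularForm.eta_ne_zero (z := w) hw)
  rw [Real.log_mul (hne hpz) (Finset.prod_ne_zero_iff.2 fun j _ => hne (hj j)),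
    Real.log_prod (fun j _ => hne (hj j)), Real.log_pow] at h
  rw [hlog _ hz, hlog _ hpz, Finset.sum_congr rfl fun j _ => hlog _ (hj j)]
  simp only [him, himp, Finset.sum_add_distrib, ← Finset.mul_sum, Finset.sum_const,
    Finset.card_range, nsmul_eq_mul]
  -- The constant comes from the imaginary parts alone: `p * z` contributes `6 log p`, and each of
  -- the `p` points `(z + j) / p` contributes `-6 log p`.
  rw [Real.log_mul hpr.ne' hz.ne', Real.log_div hz.ne' hpr.ne']
  push_cast at h
  linear_combination 24 * h

/-- Weight `12`: the factor `|cτ + d| ^ 12` gained by `|Δ|` cancels the one lost by `(Im τ) ^ 6`. -/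
theorem periodDelta_smul (γ : Matrix.SpecialLinearGroup (Fin 2) ℤ) (τ : UpperHalfPlane) :
    periodDelta ((γ • τ : UpperHalfPlane) : ℂ) = periodDelta τ := by
  have h1 := congrFun (SlashInvariantForm.slash_action_generators_SL2Z
    ModularForm.discriminant_S_invariant ModularForm.discriminant_T_invariant γ) τ
  rw [ModularForm.SL_slash_apply] at h1
  have h2 := ModularGroup.im_smul_eq_div_normSq γ τ
  set δ := UpperHalfPlane.denom
    (Matrix.SpecialLinearGroup.toGL ((Matrix.SpecialLinearGroup.map (Int.castRingHom ℝ)) γ)) τ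
    with hδ
  have hδ0 : δ ≠ 0 := UpperHalfPlane.denom_ne_zero _ τ
  have h3 : ModularForm.discriminant (γ • τ) = ModularForm.discriminant τ * δ ^ 12 := by
    rw [← h1, mul_assoc]
    have : δ ^ (-12 : ℤ) * δ ^ 12 = 1 := by
      rw [zpow_neg]
      exact inv_mul_cancel₀ (pow_ne_zero 12 hδ0)
    rw [this, mul_one]
  have h4 (σ : UpperHalfPlane) : periodDelta σ = σ.im ^ 6 * ‖ModularForm.discriminant σ‖ := rfl
  rw [h4, h4, h3, h2, Complex.normSq_eq_norm_sq, norm_mul, norm_pow]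
  have : ‖δ‖ ≠ 0 := norm_ne_zero_iff.2 hδ0
  field_simp

/-- Invariance of `‖Δ‖` under `SL(2, ℤ)`. -/
theorem periodDelta_moebius {z : ℂ} (hz : 0 < z.im) {a b c d : ℤ} (h : a * d - b * c = 1) :
    periodDelta ((a * z + b) / (c * z + d)) = periodDelta z := by
  obtain ⟨γ, hγ⟩ : ∃ γ : Matrix.SpecialLinearGroup (Fin 2) ℤ, γ.1 = !![a, b; c, d] :=
    ⟨⟨!![a, b; c, d], by rw [Matrix.det_fin_two_of, h]⟩, rfl⟩
  have := periodDelta_smul γ ⟨z, hz⟩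
  rw [UpperHalfPlane.specialLinearGroup_apply] at this
  simpa [hγ] using this

/-! ### Period lattices and `‖Δ‖` as a function of lattices. -/

/-- The oriented area of the parallelogram spanned by `v` and `u`. -/
def orientedArea (u v : ℂ) : ℝ := u.im * v.re - u.re * v.im

/-- The subgroup of `ℂ` generated by two periods. -/
def periodLattice (u v : ℂ) : AddSubgroup ℂ := AddSubgroup.closure {u, v}

theorem mem_periodLattice {u v z : ℂ} :
    z ∈ periodLattice u v ↔ ∃ m n : ℤ, (m : ℂ) * u + n * v = z := by
  simp [periodLattice, AddSubgroup.mem_closure_pair]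

theorem periodLattice_le {u v : ℂ} {S : AddSubgroup ℂ} :
    periodLattice u v ≤ S ↔ u ∈ S ∧ v ∈ S := by
  simp [periodLattice, Set.insert_subset_iff]

theorem comb_mem {S : AddSubgroup ℂ} {x y : ℂ} (hx : x ∈ S) (hy : y ∈ S) (m n : ℤ) :
    (m : ℂ) * x + n * y ∈ S := by
  simpa using S.add_mem (S.zsmul_mem hx m) (S.zsmul_mem hy n)

theorem left_mem_periodLattice (u v : ℂ) : u ∈ periodLattice u v :=
  (periodLattice_le.1 le_rfl).1

theorem right_mem_periodLattice (u v : ℂ) : v ∈ periodLattice u v :=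
  (periodLattice_le.1 le_rfl).2

theorem im_div_pos {u v : ℂ} (h : 0 < orientedArea u v) : 0 < (u / v).im := by
  have hv : v ≠ 0 := by rintro rfl; simp [orientedArea] at h
  have : (u / v).im = orientedArea u v / Complex.normSq v := by
    rw [Complex.div_im, orientedArea]
    ring
  rw [this]
  exact div_pos h (Complex.normSq_pos.2 hv)

theorem right_ne_zero_of_area {u v : ℂ} (h : 0 < orientedArea u v) : v ≠ 0 := by
  rintro rfl; simp [orientedArea] at h

theorem orientedArea_comb (u v : ℂ) (a b c d : ℝ) :
    orientedArea (a * u + b * v) (c * u + d * v) = (a * d - b * c) * orientedArea u v := by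
  simp [orientedArea]
  ring

theorem eq_zero_of_comb_eq_zero {u v : ℂ} (h : 0 < orientedArea u v) {x y : ℝ}
    (hxy : (x : ℂ) * u + y * v = 0) : x = 0 ∧ y = 0 := by
  -- Taking the area against `v`, then against `u`, isolates each coefficient.
  have h1 := orientedArea_comb u v x y 0 1
  have h2 := orientedArea_comb u v 1 0 x y
  rw [hxy] at h1 h2
  simp [orientedArea] at h1 h2
  simp only [orientedArea] at h
  exact ⟨h1.resolve_right h.ne', h2.resolve_right h.ne'⟩

theorem comb_mem_periodLattice_iff {u v : ℂ} (h : 0 < orientedArea u v) (x y : ℝ) :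
    (x : ℂ) * u + y * v ∈ periodLattice u v ↔ (∃ m : ℤ, (m : ℝ) = x) ∧ ∃ n : ℤ, (n : ℝ) = y := by
  rw [mem_periodLattice]
  constructor
  · rintro ⟨m, n, hmn⟩
    have := eq_zero_of_comb_eq_zero h (x := m - x) (y := n - y) (by
      push_cast
      linear_combination hmn)
    exact ⟨⟨m, by linarith [this.1]⟩, ⟨n, by linarith [this.2]⟩⟩
  · rintro ⟨⟨m, rfl⟩, ⟨n, rfl⟩⟩
    exact ⟨m, n, by push_cast; rfl⟩

/-- The two base changes have integral determinants with product `1`; positivity of both areas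
forces determinant `1`, so the period ratios are `SL(2, ℤ)`-equivalent. -/
theorem periodDelta_eq_of_periodLattice_eq {u v u' v' : ℂ} (h : 0 < orientedArea u v)
    (h' : 0 < orientedArea u' v') (heq : periodLattice u v = periodLattice u' v') :
    periodDelta (u / v) = periodDelta (u' / v') := by
  obtain ⟨a, b, hu⟩ := mem_periodLattice.1 (heq ▸ left_mem_periodLattice u' v')
  obtain ⟨c, d, hv⟩ := mem_periodLattice.1 (heq ▸ right_mem_periodLattice u' v')
  obtain ⟨a', b', hu'⟩ := mem_periodLattice.1 (heq ▸ left_mem_periodLattice u v)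
  obtain ⟨c', d', hv'⟩ := mem_periodLattice.1 (heq ▸ right_mem_periodLattice u v)
  have h1 := orientedArea_comb u v a b c d
  have h2 := orientedArea_comb u' v' a' b' c' d'
  push_cast at h1 h2
  rw [hu, hv] at h1
  rw [hu', hv'] at h2
  have h3 : ((a * d - b * c : ℤ) : ℝ) * ((a' * d' - b' * c' : ℤ) : ℝ) = 1 := by
    push_cast
    have : (((a : ℝ) * d - b * c) * (a' * d' - b' * c') - 1) * orientedArea u v = 0 := by
      linear_combination (-1) * h2 - (a' * d' - b' * c' : ℝ) * h1
    rcases mul_eq_zero.1 this with h4 | h4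
    · linarith
    · exact absurd h4 h.ne'
  have h4 : (0 : ℝ) < ((a * d - b * c : ℤ) : ℝ) := by
    push_cast
    by_contra hcon
    push Not at hcon
    nlinarith
  have h5 : a * d - b * c = 1 := by
    have h4' : 0 < a * d - b * c := by exact_mod_cast h4
    exact Int.eq_one_of_mul_eq_one_right h4'.le (by exact_mod_cast h3)
  rw [← periodDelta_moebius (im_div_pos h) h5, ← hu, ← hv]
  have := right_ne_zero_of_area h
  congr 1
  rw [← mul_div_mul_right _ _ this]
  congr 1 <;> field_simp

/-- A lattice in `ℂ`. -/
def IsPeriodLattice (L : AddSubgroup ℂ) : Prop :=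
  ∃ u v : ℂ, 0 < orientedArea u v ∧ L = periodLattice u v

open Classical in
/-- The value of `‖Δ‖` on the torus `ℂ / L`. -/
noncomputable def latticeDelta (L : AddSubgroup ℂ) : ℝ :=
  if h : ∃ p : ℂ × ℂ, 0 < orientedArea p.1 p.2 ∧ L = periodLattice p.1 p.2 then
    periodDelta (h.choose.1 / h.choose.2)
  else 0

theorem latticeDelta_periodLattice {u v : ℂ} (h : 0 < orientedArea u v) :
    latticeDelta (periodLattice u v) = periodDelta (u / v) := by
  have hex : ∃ p : ℂ × ℂ, 0 < orientedArea p.1 p.2 ∧ periodLattice u v = periodLattice p.1 p.2 :=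
    ⟨(u, v), h, rfl⟩
  rw [latticeDelta, dif_pos hex]
  exact (periodDelta_eq_of_periodLattice_eq h hex.choose_spec.1 hex.choose_spec.2).symm

open Pointwise in
theorem smul_periodLattice (c u v : ℂ) :
    c • periodLattice u v = periodLattice (c * u) (c * v) := by
  ext z
  rw [AddSubgroup.mem_smul_pointwise_iff_exists, mem_periodLattice]
  constructor
  · rintro ⟨s, hs, rfl⟩
    obtain ⟨m, n, rfl⟩ := mem_periodLattice.1 hs
    exact ⟨m, n, by rw [smul_eq_mul]; ring⟩
  · rintro ⟨m, n, rfl⟩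
    exact ⟨m * u + n * v, mem_periodLattice.2 ⟨m, n, rfl⟩, by rw [smul_eq_mul]; ring⟩

theorem orientedArea_mul (c u v : ℂ) :
    orientedArea (c * u) (c * v) = Complex.normSq c * orientedArea u v := by
  simp [orientedArea, Complex.normSq_apply]
  ring

open Pointwise in
theorem latticeDelta_smul {L : AddSubgroup ℂ} (hL : IsPeriodLattice L) {c : ℂ} (hc : c ≠ 0) :
    latticeDelta (c • L) = latticeDelta L := by
  obtain ⟨u, v, h, rfl⟩ := hL
  rw [smul_periodLattice, latticeDelta_periodLattice h, latticeDelta_periodLattice (by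
    rw [orientedArea_mul]
    exact mul_pos (Complex.normSq_pos.2 hc) h), mul_div_mul_left _ _ hc]

/-! ### Cyclic overlattices and the case of prime order. -/

/-- The groups `L'` that contain `L` with cyclic quotient of order `N`. -/
def cyclicOver (N : ℕ) (L : AddSubgroup ℂ) : Set (AddSubgroup ℂ) :=
  {L' | ∃ w : ℂ, L' = L ⊔ AddSubgroup.zmultiples w ∧ ∀ n : ℤ, (n : ℂ) * w ∈ L ↔ (N : ℤ) ∣ n}

theorem orientedArea_div_left (u v : ℂ) (N : ℕ) :
    orientedArea (u / N) v = orientedArea u v / N := by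
  simp only [orientedArea, Complex.div_natCast_im, Complex.div_natCast_re]
  ring

theorem orientedArea_div_right (u v : ℂ) (N : ℕ) :
    orientedArea u (v / N) = orientedArea u v / N := by
  simp only [orientedArea, Complex.div_natCast_im, Complex.div_natCast_re]
  ring

theorem orientedArea_div_left_pos {u v : ℂ} (h : 0 < orientedArea u v) {N : ℕ} (hN : 0 < N) :
    0 < orientedArea (u / N) v := by
  rw [orientedArea_div_left]; positivity

theorem orientedArea_div_right_pos {u v : ℂ} (h : 0 < orientedArea u v) {N : ℕ} (hN : 0 < N) :
    0 < orientedArea u (v / N) := by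
  rw [orientedArea_div_right]; positivity

theorem sup_zmultiples_le {L S : AddSubgroup ℂ} {w : ℂ} :
    L ⊔ AddSubgroup.zmultiples w ≤ S ↔ L ≤ S ∧ w ∈ S := by
  rw [sup_le_iff, AddSubgroup.zmultiples_le]

/-- Elementary divisors for a cyclic extension of a lattice. -/
theorem exists_adapted_basis {u v : ℂ} (h : 0 < orientedArea u v) {N : ℕ} (hN : 0 < N)
    {L' : AddSubgroup ℂ} (hL' : L' ∈ cyclicOver N (periodLattice u v)) :
    ∃ u' v' : ℂ, 0 < orientedArea u' v' ∧ periodLattice u v = periodLattice u' v' ∧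
      L' = periodLattice (u' / N) v' := by
  obtain ⟨w, rfl, hw⟩ := hL'
  have hN0 : (N : ℂ) ≠ 0 := by exact_mod_cast hN.ne'
  obtain ⟨a, b, hab⟩ := mem_periodLattice.1 ((hw N).2 dvd_rfl)
  push_cast at hab
  -- Here `a, b` are the coordinates of `N w`; both vanish only if `w = 0`, which forces `N = 1`.
  rcases Nat.eq_zero_or_pos (Int.gcd a b) with hg | hg
  · rw [Int.gcd_eq_zero_iff] at hg
    have hw0 : w = 0 := by
      rw [hg.1, hg.2] at hab
      simpa [hN0] using hab.symm
    have hN1 : N = 1 := by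
      have := (hw 1).1 (by rw [hw0, mul_zero]; exact zero_mem _)
      exact Nat.eq_one_of_dvd_one (by exact_mod_cast this)
    refine ⟨u, v, h, rfl, ?_⟩
    simp [hw0, hN1]
  · obtain ⟨a1, ha1⟩ := Int.gcd_dvd_left a b
    obtain ⟨b1, hb1⟩ := Int.gcd_dvd_right a b
    have hbez := Int.gcd_eq_gcd_ab a b
    set g := Int.gcd a b with hgdef
    set x := Int.gcdA a b
    set y := Int.gcdB a b
    have hgz : (g : ℤ) ≠ 0 := by exact_mod_cast hg.ne'
    have hxy : a1 * x + b1 * y = 1 := by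
      have : (g : ℤ) * (a1 * x + b1 * y) = g * 1 := by
        rw [mul_one]
        conv_rhs => rw [hbez, ha1, hb1]
        ring
      exact mul_left_cancel₀ hgz this
    have hxyC : (a1 : ℂ) * x + b1 * y = 1 := by exact_mod_cast hxy
    have hxyR : (a1 : ℝ) * x + b1 * y = 1 := by exact_mod_cast hxy
    -- The primitive vector in the direction of `N w`, completed by the Bézout coefficients to a
    -- basis of determinant `1`.
    set u' : ℂ := a1 * u + b1 * v with hu'
    set v' : ℂ := -y * u + x * v with hv'
    have hA : orientedArea u' v' = orientedArea u v := by
      have := orientedArea_comb u v a1 b1 (-y) x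
      push_cast at this
      rw [this]
      linear_combination orientedArea u v * hxyR
    have hlat : periodLattice u v = periodLattice u' v' := by
      refine le_antisymm (periodLattice_le.2 ⟨?_, ?_⟩) (periodLattice_le.2 ⟨?_, ?_⟩)
      · exact mem_periodLattice.2 ⟨x, -b1, by push_cast; linear_combination u * hxyC⟩
      · exact mem_periodLattice.2 ⟨y, a1, by linear_combination v * hxyC⟩
      · exact mem_periodLattice.2 ⟨a1, b1, rfl⟩
      · exact mem_periodLattice.2 ⟨-y, x, by push_cast; rfl⟩
    have hwu : w = g * (u' / N) := by
      have h1 : (N : ℂ) * w = g * u' := by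
        rw [← hab, ha1, hb1]
        push_cast
        ring
      field_simp
      linear_combination h1
    -- A common divisor `d` would already put `(N / d) w` in the lattice, against the exact order
    -- `N` of `w`.
    have hcop : Nat.gcd g N = 1 := by
      set d := Nat.gcd g N with hd
      obtain ⟨g1, hg1⟩ := Nat.gcd_dvd_left g N
      obtain ⟨N1, hN1⟩ := Nat.gcd_dvd_right g N
      rw [← hd] at hg1 hN1
      have hN1pos : 0 < N1 := Nat.pos_of_ne_zero (by rintro rfl; omega)
      have hmem : ((N1 : ℤ) : ℂ) * w ∈ periodLattice u v := by
        rw [hlat]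
        refine mem_periodLattice.2 ⟨g1, 0, ?_⟩
        have e1 : (N : ℂ) = d * N1 := by exact_mod_cast hN1
        have e2 : (g : ℂ) = d * g1 := by exact_mod_cast hg1
        rw [hwu, e2]
        push_cast
        field_simp
        rw [e1]
        ring
      have hdvd : N ∣ N1 := by exact_mod_cast (hw N1).1 hmem
      have hle := Nat.le_of_dvd hN1pos hdvd
      have hdpos : 0 < d := Nat.pos_of_ne_zero (by intro h0; rw [h0] at hN1; omega)
      nlinarith
    refine ⟨u', v', hA ▸ h, hlat, ?_⟩
    -- With `g s + N t = 1` one has `u' / N = s w + t u'`, so `w` generates the same extension as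
    -- `u' / N`.
    have hst := Nat.gcd_eq_gcd_ab g N
    rw [hcop] at hst
    have hstC : (1 : ℂ) = g * Nat.gcdA g N + N * Nat.gcdB g N := by exact_mod_cast hst
    rw [hlat]
    refine le_antisymm (sup_zmultiples_le.2 ⟨periodLattice_le.2 ⟨?_, ?_⟩, ?_⟩)
      (periodLattice_le.2 ⟨?_, ?_⟩)
    · exact mem_periodLattice.2 ⟨N, 0, by push_cast; field_simp; ring⟩
    · exact right_mem_periodLattice _ _
    · exact mem_periodLattice.2 ⟨g, 0, by rw [hwu]; push_cast; ring⟩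
    · have h1 : w ∈ periodLattice u' v' ⊔ AddSubgroup.zmultiples w :=
        AddSubgroup.mem_sup_right (AddSubgroup.mem_zmultiples w)
      have h2 : u' ∈ periodLattice u' v' ⊔ AddSubgroup.zmultiples w :=
        AddSubgroup.mem_sup_left (left_mem_periodLattice _ _)
      have h3 := comb_mem h1 h2 (Nat.gcdA g N) (Nat.gcdB g N)
      convert! h3 using 1
      rw [hwu]
      field_simp
      linear_combination u' * hstC
    · exact AddSubgroup.mem_sup_left (right_mem_periodLattice _ _)

theorem orientedArea_add_div_pos {u v : ℂ} (h : 0 < orientedArea u v) (k : ℕ) {N : ℕ}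
    (hN : 0 < N) : 0 < orientedArea ((u + k * v) / N) v := by
  rw [orientedArea_div_left]
  have := orientedArea_comb u v 1 k 0 1
  simp only [Complex.ofReal_one, Complex.ofReal_zero, one_mul, zero_mul, zero_add, mul_zero,
    sub_zero, Complex.ofReal_natCast, mul_one] at this
  rw [this]
  positivity

theorem exists_int_eq_div_iff {N : ℕ} (hN : 0 < N) (n : ℤ) :
    (∃ m : ℤ, (m : ℝ) = n / N) ↔ (N : ℤ) ∣ n := by
  have : (N : ℝ) ≠ 0 := by exact_mod_cast hN.ne'
  constructor
  · rintro ⟨m, hm⟩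
    refine ⟨m, ?_⟩
    rw [eq_div_iff this] at hm
    have : m * (N : ℤ) = n := by exact_mod_cast hm
    rw [← this, mul_comm]
  · rintro ⟨m, rfl⟩
    exact ⟨m, by push_cast; field_simp⟩

theorem periodLattice_mem_cyclicOver {u v : ℂ} (h : 0 < orientedArea u v) (k : ℕ) {N : ℕ}
    (hN : 0 < N) : periodLattice ((u + k * v) / N) v ∈ cyclicOver N (periodLattice u v) := by
  have hN0 : (N : ℂ) ≠ 0 := by exact_mod_cast hN.ne'
  refine ⟨(u + k * v) / N, ?_, fun n => ?_⟩
  · refine le_antisymm (periodLattice_le.2 ⟨?_, ?_⟩)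
      (sup_zmultiples_le.2 ⟨periodLattice_le.2 ⟨?_, ?_⟩, ?_⟩)
    · exact AddSubgroup.mem_sup_right (AddSubgroup.mem_zmultiples _)
    · exact AddSubgroup.mem_sup_left (right_mem_periodLattice _ _)
    · exact mem_periodLattice.2 ⟨N, -k, by push_cast; field_simp; ring⟩
    · exact right_mem_periodLattice _ _
    · exact left_mem_periodLattice _ _
  · have e : (n : ℂ) * ((u + k * v) / N) =
        ((n / N : ℝ) : ℂ) * u + ((n * k / N : ℝ) : ℂ) * v := by
      push_cast; ring
    rw [e, comb_mem_periodLattice_iff h, exists_int_eq_div_iff hN]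
    refine ⟨fun h => h.1, fun h => ⟨h, ?_⟩⟩
    have := (exists_int_eq_div_iff hN (n * k)).2 (h.mul_right _)
    push_cast at this
    exact this

/-- Chinese remainder theorem: for coprime `p` and `M` the quotient `ℤ/M × ℤ/p` is cyclic, generated
by `u / M + v / p`. -/
theorem periodLattice_mem_cyclicOver_mul {u v : ℂ} (h : 0 < orientedArea u v) {p M : ℕ}
    (hp : 0 < p) (hM : 0 < M) (hc : p.Coprime M) :
    periodLattice (u / M) (v / p) ∈ cyclicOver (p * M) (periodLattice u v) := by
  have hp0 : (p : ℂ) ≠ 0 := by exact_mod_cast hp.ne'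
  have hM0 : (M : ℂ) ≠ 0 := by exact_mod_cast hM.ne'
  refine ⟨u / M + v / p, ?_, fun n => ?_⟩
  · have hst := Nat.gcd_eq_gcd_ab p M
    rw [hc] at hst
    have hstC : (1 : ℂ) = p * Nat.gcdA p M + M * Nat.gcdB p M := by exact_mod_cast hst
    set s := Nat.gcdA p M
    set t := Nat.gcdB p M
    refine le_antisymm (periodLattice_le.2 ⟨?_, ?_⟩)
      (sup_zmultiples_le.2 ⟨periodLattice_le.2 ⟨?_, ?_⟩, ?_⟩)
    all_goals
      try have h1 : u ∈ periodLattice u v ⊔ AddSubgroup.zmultiples (u / M + v / p) :=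
        AddSubgroup.mem_sup_left (left_mem_periodLattice _ _)
      try have h2 : v ∈ periodLattice u v ⊔ AddSubgroup.zmultiples (u / M + v / p) :=
        AddSubgroup.mem_sup_left (right_mem_periodLattice _ _)
      try have h3 : u / M + v / p ∈ periodLattice u v ⊔ AddSubgroup.zmultiples (u / M + v / p) :=
        AddSubgroup.mem_sup_right (AddSubgroup.mem_zmultiples _)
    · have h4 := comb_mem (comb_mem h1 h2 t (-s)) h3 1 (p * s)
      convert! h4 using 1
      push_cast
      field_simp
      linear_combination u * hstC
    · have h4 := comb_mem (comb_mem h1 h2 (-t) s) h3 1 (M * t)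
      convert! h4 using 1
      push_cast
      field_simp
      linear_combination v * hstC
    · exact mem_periodLattice.2 ⟨M, 0, by push_cast; field_simp; ring⟩
    · exact mem_periodLattice.2 ⟨0, p, by push_cast; field_simp; ring⟩
    · exact mem_periodLattice.2 ⟨1, 1, by push_cast; ring⟩
  · have e : (n : ℂ) * (u / M + v / p) =
        ((n / M : ℝ) : ℂ) * u + ((n / p : ℝ) : ℂ) * v := by
      push_cast; ring
    rw [e, comb_mem_periodLattice_iff h, exists_int_eq_div_iff hM, exists_int_eq_div_iff hp]
    constructor
    · rintro ⟨h1, h2⟩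
      push_cast
      exact (Nat.isCoprime_iff_coprime.2 hc).mul_dvd h2 h1
    · intro h
      push_cast at h
      exact ⟨(Dvd.intro_left _ rfl).trans h, (Dvd.intro _ rfl).trans h⟩

/-- Index-`p` overlattices are the points of the projective line over `𝔽_p`: a generator `(a u + b
v) / p` matters only through `b / a` modulo `p`, with `a ≡ 0` as the point at infinity. -/
theorem cyclicOver_prime {u v : ℂ} (h : 0 < orientedArea u v) {p : ℕ} (hp : p.Prime) :
    cyclicOver p (periodLattice u v) = insert (periodLattice u (v / p))
      ((fun j : ℕ => periodLattice ((u + j * v) / p) v) '' (Finset.range p : Set ℕ)) := by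
  have hp0 : (p : ℂ) ≠ 0 := by exact_mod_cast hp.ne_zero
  apply Set.Subset.antisymm
  · rintro _ ⟨w, rfl, hw⟩
    obtain ⟨a, b, hab⟩ := mem_periodLattice.1 ((hw p).2 dvd_rfl)
    push_cast at hab
    have hw' : w = (a * u + b * v) / p := by rw [hab]; field_simp
    have hwS : w ∈ periodLattice u v ⊔ AddSubgroup.zmultiples w :=
      AddSubgroup.mem_sup_right (AddSubgroup.mem_zmultiples _)
    have huS : u ∈ periodLattice u v ⊔ AddSubgroup.zmultiples w :=
      AddSubgroup.mem_sup_left (left_mem_periodLattice _ _)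
    have hvS : v ∈ periodLattice u v ⊔ AddSubgroup.zmultiples w :=
      AddSubgroup.mem_sup_left (right_mem_periodLattice _ _)
    have hpI : Prime (p : ℤ) := Nat.prime_iff_prime_int.1 hp
    by_cases ha : (p : ℤ) ∣ a
    · left
      obtain ⟨a', rfl⟩ := ha
      have hb : ¬ (p : ℤ) ∣ b := by
        rintro ⟨b', rfl⟩
        have : ((1 : ℤ) : ℂ) * w ∈ periodLattice u v :=
          mem_periodLattice.2 ⟨a', b', by rw [hw']; push_cast; field_simp⟩
        exact hpI.not_dvd_one ((hw 1).1 this)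
      obtain ⟨s, t, hst⟩ := (hpI.coprime_iff_not_dvd).2 hb
      have hstC : (s : ℂ) * p + t * b = 1 := by exact_mod_cast hst
      refine le_antisymm (sup_zmultiples_le.2 ⟨periodLattice_le.2 ⟨?_, ?_⟩, ?_⟩)
        (periodLattice_le.2 ⟨huS, ?_⟩)
      · exact left_mem_periodLattice _ _
      · exact mem_periodLattice.2 ⟨0, p, by push_cast; field_simp; ring⟩
      · exact mem_periodLattice.2 ⟨a', b, by rw [hw']; push_cast; field_simp⟩
      · convert! comb_mem (comb_mem huS hvS (-t * a') s) hwS 1 t using 1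
        rw [hw']
        push_cast
        field_simp
        linear_combination (-v) * hstC
    · right
      obtain ⟨s, t, hst⟩ := (hpI.coprime_iff_not_dvd).2 ha
      have hstC : (s : ℂ) * p + t * a = 1 := by exact_mod_cast hst
      have hpz : (p : ℤ) ≠ 0 := by exact_mod_cast hp.ne_zero
      -- `t` inverts `a` modulo `p`, so `j` is the residue of `b / a`.
      set j : ℕ := ((t * b) % p).toNat with hj
      have hj' : (j : ℤ) = (t * b) % p := Int.toNat_of_nonneg (Int.emod_nonneg _ hpz)
      set q : ℤ := (t * b) / p with hq
      have hjq : (j : ℤ) + p * q = t * b := by rw [hj']; exact Int.emod_add_mul_ediv _ _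
      have hjqC : (j : ℂ) + p * q = t * b := by exact_mod_cast hjq
      refine ⟨j, ?_, ?_⟩
      · rw [Finset.coe_range, Set.mem_Iio]
        have := Int.emod_lt_of_pos (t * b) (show (0 : ℤ) < p by exact_mod_cast hp.pos)
        rw [← hj'] at this
        exact_mod_cast this
      · refine le_antisymm (periodLattice_le.2 ⟨?_, hvS⟩)
          (sup_zmultiples_le.2 ⟨periodLattice_le.2 ⟨?_, ?_⟩, ?_⟩)
        · convert! comb_mem (comb_mem huS hvS s (-q)) hwS 1 t using 1
          rw [hw']
          push_cast
          field_simp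
          linear_combination (-u) * hstC + v * hjqC
        · exact mem_periodLattice.2 ⟨p, -j, by push_cast; field_simp; ring⟩
        · exact right_mem_periodLattice _ _
        · refine mem_periodLattice.2 ⟨a, s * b + a * q, ?_⟩
          rw [hw']
          push_cast
          field_simp
          linear_combination (b * v) * hstC + a * v * hjqC
  · intro L hL
    rcases hL with rfl | ⟨j, -, rfl⟩
    · simpa using periodLattice_mem_cyclicOver_mul h hp.pos one_pos (Nat.coprime_one_right p)
    · exact periodLattice_mem_cyclicOver h j hp.pos

theorem periodLattice_right_ne {u v : ℂ} (h : 0 < orientedArea u v) {p : ℕ} (hp : p.Prime)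
    (j : ℕ) : periodLattice u (v / p) ≠ periodLattice ((u + j * v) / p) v := by
  intro heq
  have h1 : v / p ∈ periodLattice ((u + j * v) / p) v := heq ▸ right_mem_periodLattice _ _
  have e : v / p = ((0 : ℝ) : ℂ) * ((u + j * v) / p) + (((1 : ℤ) / p : ℝ) : ℂ) * v := by
    push_cast; ring
  rw [e, comb_mem_periodLattice_iff (orientedArea_add_div_pos h j hp.pos),
    exists_int_eq_div_iff hp.pos] at h1
  exact (Nat.prime_iff_prime_int.1 hp).not_dvd_one h1.2

theorem injOn_periodLattice_add_div {u v : ℂ} (h : 0 < orientedArea u v) {p : ℕ} (hp : 0 < p) :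
    Set.InjOn (fun j : ℕ => periodLattice ((u + j * v) / p) v) (Finset.range p : Set ℕ) := by
  intro i hi j hj heq
  simp only [Finset.coe_range, Set.mem_Iio] at hi hj heq
  have h1 : (u + i * v) / p ∈ periodLattice ((u + j * v) / p) v :=
    heq ▸ left_mem_periodLattice _ _
  have e : (u + i * v) / p =
      ((1 : ℝ) : ℂ) * ((u + j * v) / p) + (((i - j : ℤ) / p : ℝ) : ℂ) * v := by
    push_cast; ring
  rw [e, comb_mem_periodLattice_iff (orientedArea_add_div_pos h j hp),
    exists_int_eq_div_iff hp] at h1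
  have := Int.eq_zero_of_abs_lt_dvd h1.2 (abs_lt.2 ⟨by omega, by omega⟩)
  omega

theorem cyclicOver_prime_finite {L : AddSubgroup ℂ} (hL : IsPeriodLattice L) {p : ℕ}
    (hp : p.Prime) : (cyclicOver p L).Finite := by
  obtain ⟨u, v, h, rfl⟩ := hL
  rw [cyclicOver_prime h hp]
  exact ((Finset.finite_toSet _).image _).insert _

theorem finsum_cyclicOver_prime {u v : ℂ} (h : 0 < orientedArea u v) {p : ℕ} (hp : p.Prime)
    (f : AddSubgroup ℂ → ℝ) :
    ∑ᶠ L ∈ cyclicOver p (periodLattice u v), f L = f (periodLattice u (v / p)) +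
      ∑ j ∈ Finset.range p, f (periodLattice ((u + j * v) / p) v) := by
  rw [cyclicOver_prime h hp, finsum_mem_insert, finsum_mem_image
    (injOn_periodLattice_add_div h hp.pos), finsum_mem_coe_finset]
  · rintro ⟨j, -, hj⟩
    exact periodLattice_right_ne h hp j hj.symm
  · exact (Finset.finite_toSet _).image _

theorem IsPeriodLattice.of_mem_cyclicOver {N : ℕ} (hN : 0 < N) {L L' : AddSubgroup ℂ}
    (hL : IsPeriodLattice L) (h : L' ∈ cyclicOver N L) : IsPeriodLattice L' := by
  obtain ⟨u, v, hA, rfl⟩ := hL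
  obtain ⟨u', v', hA', -, rfl⟩ := exists_adapted_basis hA hN h
  exact ⟨_, _, orientedArea_div_left_pos hA' hN, rfl⟩

/-- The Hecke relation at a prime `p` for `log ‖Δ‖` as a function on lattices. -/
theorem finsum_log_latticeDelta_prime {L : AddSubgroup ℂ} (hL : IsPeriodLattice L) {p : ℕ}
    (hp : p.Prime) : ∑ᶠ L' ∈ cyclicOver p L, Real.log (latticeDelta L') =
      (p + 1) * Real.log (latticeDelta L) + 6 * (1 - p) * Real.log p := by
  obtain ⟨u, v, h, rfl⟩ := hL
  have hv := right_ne_zero_of_area h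
  have hp0 : (p : ℂ) ≠ 0 := by exact_mod_cast hp.ne_zero
  rw [finsum_cyclicOver_prime h hp, latticeDelta_periodLattice h,
    latticeDelta_periodLattice (orientedArea_div_right_pos h hp.pos),
    ← log_periodDelta_hecke hp (im_div_pos h)]
  congr 1
  · congr 2
    field_simp
  · refine Finset.sum_congr rfl fun j _ => ?_
    rw [latticeDelta_periodLattice (orientedArea_add_div_pos h j hp.pos)]
    congr 2
    field_simp

/-! ### The tower `L ⊆ L + p L' ⊆ L'` and its fibres. -/

open Pointwise in
theorem sup_smul_periodLattice_add (u v : ℂ) {p M : ℕ} (hp : 0 < p) (hM : 0 < M) (j : ℕ) :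
    periodLattice u v ⊔ (p : ℂ) • periodLattice ((u / M + j * v) / p) v =
      periodLattice (u / M) v := by
  have hp0 : (p : ℂ) ≠ 0 := by exact_mod_cast hp.ne'
  have hM0 : (M : ℂ) ≠ 0 := by exact_mod_cast hM.ne'
  rw [smul_periodLattice, mul_div_cancel₀ _ hp0]
  refine le_antisymm (sup_le (periodLattice_le.2 ⟨?_, ?_⟩) (periodLattice_le.2 ⟨?_, ?_⟩))
    (periodLattice_le.2 ⟨?_, ?_⟩)
  · exact mem_periodLattice.2 ⟨M, 0, by push_cast; field_simp; ring⟩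
  · exact right_mem_periodLattice _ _
  · exact mem_periodLattice.2 ⟨1, j, by push_cast; ring⟩
  · exact mem_periodLattice.2 ⟨0, p, by push_cast; ring⟩
  · have h1 := comb_mem (AddSubgroup.mem_sup_right (S := periodLattice u v)
      (left_mem_periodLattice (u / M + j * v) (p * v)))
      (AddSubgroup.mem_sup_left (right_mem_periodLattice u v)) 1 (-j)
    convert! h1 using 1
    push_cast
    ring
  · exact AddSubgroup.mem_sup_left (right_mem_periodLattice _ _)

open Pointwise in
theorem sup_smul_periodLattice_coprime (u v : ℂ) {p M : ℕ} (hp : 0 < p) (hM : 0 < M)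
    (hc : p.Coprime M) : periodLattice u v ⊔ (p : ℂ) • periodLattice (u / M) (v / p) =
      periodLattice (u / M) v := by
  have hp0 : (p : ℂ) ≠ 0 := by exact_mod_cast hp.ne'
  have hM0 : (M : ℂ) ≠ 0 := by exact_mod_cast hM.ne'
  have hst := Nat.gcd_eq_gcd_ab p M
  rw [hc] at hst
  have hstC : (1 : ℂ) = p * Nat.gcdA p M + M * Nat.gcdB p M := by exact_mod_cast hst
  rw [smul_periodLattice, mul_div_cancel₀ _ hp0]
  refine le_antisymm (sup_le (periodLattice_le.2 ⟨?_, ?_⟩) (periodLattice_le.2 ⟨?_, ?_⟩))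
    (periodLattice_le.2 ⟨?_, ?_⟩)
  · exact mem_periodLattice.2 ⟨M, 0, by push_cast; field_simp; ring⟩
  · exact right_mem_periodLattice _ _
  · exact mem_periodLattice.2 ⟨p, 0, by push_cast; ring⟩
  · exact right_mem_periodLattice _ _
  · have h1 := comb_mem (AddSubgroup.mem_sup_right (S := periodLattice u v)
      (left_mem_periodLattice (p * (u / M)) v))
      (AddSubgroup.mem_sup_left (left_mem_periodLattice u v)) (Nat.gcdA p M) (Nat.gcdB p M)
    convert! h1 using 1
    field_simp
    linear_combination u * hstC
  · exact AddSubgroup.mem_sup_left (right_mem_periodLattice _ _)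

theorem sup_periodLattice_div (u v : ℂ) {M : ℕ} (hM : 0 < M) {w : ℂ}
    (hw : w ∈ periodLattice u v) :
    periodLattice u v ⊔ periodLattice (u / M) w = periodLattice (u / M) v := by
  have hM0 : (M : ℂ) ≠ 0 := by exact_mod_cast hM.ne'
  have hle : periodLattice u v ≤ periodLattice (u / M) v :=
    periodLattice_le.2 ⟨mem_periodLattice.2 ⟨M, 0, by push_cast; field_simp; ring⟩,
      right_mem_periodLattice _ _⟩
  refine le_antisymm (sup_le hle (periodLattice_le.2 ⟨left_mem_periodLattice _ _, hle hw⟩))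
    (periodLattice_le.2 ⟨?_, ?_⟩)
  · exact AddSubgroup.mem_sup_right (left_mem_periodLattice _ _)
  · exact AddSubgroup.mem_sup_left (right_mem_periodLattice _ _)

open Pointwise in
theorem sup_smul_periodLattice_dvd (u v : ℂ) {p M : ℕ} (hp : 0 < p) (hM : 0 < M) :
    periodLattice u v ⊔ (p : ℂ) • periodLattice (u / (p * M : ℕ)) (v / p) =
      periodLattice (u / M) v := by
  have hp0 : (p : ℂ) ≠ 0 := by exact_mod_cast hp.ne'
  have e : (p : ℂ) * (u / (p * M : ℕ)) = u / M := by push_cast; field_simp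
  rw [smul_periodLattice, mul_div_cancel₀ _ hp0, e]
  exact sup_periodLattice_div u v hM (right_mem_periodLattice _ _)

open Pointwise in
theorem sup_smul_periodLattice_mul (u v : ℂ) {p M : ℕ} (hp : 0 < p) (hM : 0 < M) :
    periodLattice u v ⊔ (p : ℂ) • periodLattice (u / (p * M : ℕ)) v =
      periodLattice (u / M) v := by
  have hp0 : (p : ℂ) ≠ 0 := by exact_mod_cast hp.ne'
  have e : (p : ℂ) * (u / (p * M : ℕ)) = u / M := by push_cast; field_simp
  rw [smul_periodLattice, e]
  exact sup_periodLattice_div u v hM (mem_periodLattice.2 ⟨0, p, by push_cast; ring⟩)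

open Pointwise in
/-- The cyclic extensions `L'` of `L` of order `p * M` whose subextension of order `M` is `L₁`. -/
def cyclicFiber (p M : ℕ) (L L₁ : AddSubgroup ℂ) : Set (AddSubgroup ℂ) :=
  {L' | L' ∈ cyclicOver (p * M) L ∧ L ⊔ (p : ℂ) • L' = L₁}

theorem periodLattice_div_mem_cyclicOver {u v : ℂ} (h : 0 < orientedArea u v) {N : ℕ}
    (hN : 0 < N) : periodLattice (u / N) v ∈ cyclicOver N (periodLattice u v) := by
  simpa using periodLattice_mem_cyclicOver h 0 hN

/-- In a basis adapted to `L'`, the lattices `L`, `L₁`, `L'` are spanned by `v` and `u`, `u / M`, `u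
/ (p M)` respectively. -/
theorem cyclicFiber_subset {p M : ℕ} (hp : 0 < p) (hM : 0 < M) {L L₁ : AddSubgroup ℂ}
    (hL : IsPeriodLattice L) : cyclicFiber p M L L₁ ⊆ cyclicOver p L₁ := by
  rintro L' ⟨h1, rfl⟩
  obtain ⟨u, v, h, rfl⟩ := hL
  have hpM : 0 < p * M := Nat.mul_pos hp hM
  obtain ⟨u', v', h', heq, rfl⟩ := exists_adapted_basis h hpM h1
  rw [heq, sup_smul_periodLattice_mul u' v' hp hM]
  have e : u' / ((p * M : ℕ) : ℂ) = u' / M / p := by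
    push_cast
    rw [div_div, mul_comm]
  rw [e]
  exact periodLattice_div_mem_cyclicOver (orientedArea_div_left_pos h' hM) hp

theorem sup_smul_mem_cyclicOver {p M : ℕ} (hp : 0 < p) (hM : 0 < M) {L L' : AddSubgroup ℂ}
    (hL : IsPeriodLattice L) (h1 : L' ∈ cyclicOver (p * M) L) :
    (open Pointwise in L ⊔ (p : ℂ) • L') ∈ cyclicOver M L := by
  obtain ⟨u, v, h, rfl⟩ := hL
  obtain ⟨u', v', h', heq, rfl⟩ := exists_adapted_basis h (Nat.mul_pos hp hM) h1
  rw [heq, sup_smul_periodLattice_mul u' v' hp hM]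
  exact periodLattice_div_mem_cyclicOver h' hM

theorem periodLattice_mem_cyclicFiber {u v : ℂ} (h : 0 < orientedArea u v) {p M : ℕ}
    (hp : 0 < p) (hM : 0 < M) (j : ℕ) : periodLattice ((u / M + j * v) / p) v ∈
      cyclicFiber p M (periodLattice u v) (periodLattice (u / M) v) := by
  refine ⟨?_, sup_smul_periodLattice_add u v hp hM j⟩
  have e : (u / M + j * v) / p = (u + ((j * M : ℕ) : ℂ) * v) / ((p * M : ℕ) : ℂ) := by
    have hM0 : (M : ℂ) ≠ 0 := by exact_mod_cast hM.ne'
    push_cast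
    field_simp
  rw [e]
  exact periodLattice_mem_cyclicOver h _ (Nat.mul_pos hp hM)

theorem cyclicFiber_eq_of_not_dvd {u v : ℂ} (h : 0 < orientedArea u v) {p M : ℕ}
    (hp : p.Prime) (hM : 0 < M) (hpM : ¬ p ∣ M) :
    cyclicFiber p M (periodLattice u v) (periodLattice (u / M) v) =
      cyclicOver p (periodLattice (u / M) v) := by
  refine Set.Subset.antisymm (cyclicFiber_subset hp.pos hM ⟨u, v, h, rfl⟩) ?_
  rw [cyclicOver_prime (orientedArea_div_left_pos h hM) hp]
  have hc := (Nat.Prime.coprime_iff_not_dvd hp).2 hpM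
  rintro L' (rfl | ⟨j, -, rfl⟩)
  · exact ⟨periodLattice_mem_cyclicOver_mul h hp.pos hM hc,
      sup_smul_periodLattice_coprime u v hp.pos hM hc⟩
  · exact periodLattice_mem_cyclicFiber h hp.pos hM j

/-- The `p` overlattices obtained from `(u / M + j v) / p` always lie in the fibre; only the one at
infinity can be missing. -/
theorem insert_cyclicFiber {u v : ℂ} (h : 0 < orientedArea u v) {p M : ℕ}
    (hp : p.Prime) (hM : 0 < M) :
    insert (periodLattice (u / M) (v / p))
      (cyclicFiber p M (periodLattice u v) (periodLattice (u / M) v)) =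
      cyclicOver p (periodLattice (u / M) v) := by
  refine Set.Subset.antisymm (Set.insert_subset ?_
    (cyclicFiber_subset hp.pos hM ⟨u, v, h, rfl⟩)) ?_
  · rw [cyclicOver_prime (orientedArea_div_left_pos h hM) hp]
    exact Set.mem_insert _ _
  · rw [cyclicOver_prime (orientedArea_div_left_pos h hM) hp]
    refine Set.insert_subset_insert ?_
    rintro _ ⟨j, -, rfl⟩
    exact periodLattice_mem_cyclicFiber h hp.pos hM j

/-- For this `L'` and `M = p M'`, the lattice `L + p L'` is spanned by `u / M'` and `v`, which is
too small to contain `u / M`. -/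
theorem notMem_cyclicFiber_of_dvd {u v : ℂ} (h : 0 < orientedArea u v) {p M : ℕ}
    (hp : p.Prime) (hM : 0 < M) (hpM : p ∣ M) : periodLattice (u / M) (v / p) ∉
      cyclicFiber p M (periodLattice u v) (periodLattice (u / M) v) := by
  rintro ⟨-, h2⟩
  obtain ⟨M', rfl⟩ := hpM
  have hM' : 0 < M' := Nat.pos_of_mul_pos_left hM
  rw [sup_smul_periodLattice_dvd u v hp.pos hM'] at h2
  have h3 : u / (p * M' : ℕ) ∈ periodLattice (u / M') v := h2 ▸ left_mem_periodLattice _ _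
  have e : u / (p * M' : ℕ) = (((1 : ℤ) / p : ℝ) : ℂ) * (u / M') + ((0 : ℝ) : ℂ) * v := by
    push_cast
    field_simp
    ring
  rw [e, comb_mem_periodLattice_iff (orientedArea_div_left_pos h hM'),
    exists_int_eq_div_iff hp.pos] at h3
  exact (Nat.prime_iff_prime_int.1 hp).not_dvd_one h3.1

-- For `p ∣ M`, `p` times the missing overlattice is exactly `L + p L₁`, so homothety invariance
-- turns the correction into a value at a lattice of lower level.
open Pointwise in
theorem finsum_cyclicFiber {p M : ℕ} (hp : p.Prime) (hM : 0 < M) {L L₁ : AddSubgroup ℂ}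
    (hL : IsPeriodLattice L) (hL₁ : L₁ ∈ cyclicOver M L) {f : AddSubgroup ℂ → ℝ}
    (hf : ∀ L : AddSubgroup ℂ, IsPeriodLattice L → ∀ c : ℂ, c ≠ 0 → f (c • L) = f L) :
    ∑ᶠ L' ∈ cyclicFiber p M L L₁, f L' =
      ∑ᶠ L' ∈ cyclicOver p L₁, f L' - if p ∣ M then f (L ⊔ (p : ℂ) • L₁) else 0 := by
  have hL₁' := hL.of_mem_cyclicOver hM hL₁
  obtain ⟨u₀, v₀, h₀, rfl⟩ := hL
  obtain ⟨u, v, h, heq, rfl⟩ := exists_adapted_basis h₀ hM hL₁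
  have hp0 : (p : ℂ) ≠ 0 := by exact_mod_cast hp.ne_zero
  rw [heq]
  split_ifs with hpM
  · rw [← insert_cyclicFiber h hp hM, finsum_mem_insert _
      (notMem_cyclicFiber_of_dvd h hp hM hpM) ((cyclicOver_prime_finite hL₁' hp).subset
        (cyclicFiber_subset hp.pos hM ⟨u, v, h, rfl⟩))]
    have hA := orientedArea_div_right_pos (orientedArea_div_left_pos h hM) hp.pos
    rw [← hf _ ⟨_, _, hA, rfl⟩ p hp0]
    obtain ⟨M', rfl⟩ := hpM
    have hM' : 0 < M' := Nat.pos_of_mul_pos_left hM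
    rw [sup_smul_periodLattice_mul u v hp.pos hM', smul_periodLattice, mul_div_cancel₀ _ hp0]
    have e : (p : ℂ) * (u / (p * M' : ℕ)) = u / M' := by push_cast; field_simp
    rw [e, add_sub_cancel_left]
  · rw [cyclicFiber_eq_of_not_dvd h hp hM hpM, sub_zero]

theorem cyclicOver_mul_eq_iUnion {p M : ℕ} (hp : 0 < p) (hM : 0 < M) {L : AddSubgroup ℂ}
    (hL : IsPeriodLattice L) :
    cyclicOver (p * M) L = ⋃ L₁ ∈ cyclicOver M L, cyclicFiber p M L L₁ := by
  ext L'
  simp only [Set.mem_iUnion, exists_prop]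
  exact ⟨fun h => ⟨_, sup_smul_mem_cyclicOver hp hM hL h, h, rfl⟩, fun ⟨_, _, h⟩ => h.1⟩

theorem cyclicFiber_finite {p M : ℕ} (hp : p.Prime) (hM : 0 < M) {L L₁ : AddSubgroup ℂ}
    (hL : IsPeriodLattice L) (hL₁ : L₁ ∈ cyclicOver M L) : (cyclicFiber p M L L₁).Finite :=
  (cyclicOver_prime_finite (hL.of_mem_cyclicOver hM hL₁) hp).subset
    (cyclicFiber_subset hp.pos hM hL)

theorem cyclicOver_mul_finite {p M : ℕ} (hp : p.Prime) (hM : 0 < M) {L : AddSubgroup ℂ}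
    (hL : IsPeriodLattice L) (hfin : (cyclicOver M L).Finite) : (cyclicOver (p * M) L).Finite := by
  rw [cyclicOver_mul_eq_iUnion hp.pos hM hL]
  exact hfin.biUnion fun L₁ h => cyclicFiber_finite hp hM hL h

theorem finsum_cyclicOver_mul {p M : ℕ} (hp : p.Prime) (hM : 0 < M) {L : AddSubgroup ℂ}
    (hL : IsPeriodLattice L) (hfin : (cyclicOver M L).Finite) (f : AddSubgroup ℂ → ℝ) :
    ∑ᶠ L' ∈ cyclicOver (p * M) L, f L' =
      ∑ᶠ L₁ ∈ cyclicOver M L, ∑ᶠ L' ∈ cyclicFiber p M L L₁, f L' := by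
  rw [cyclicOver_mul_eq_iUnion hp.pos hM hL]
  refine finsum_mem_biUnion ?_ hfin fun L₁ h => cyclicFiber_finite hp hM hL h
  intro L₁ _ L₂ _ hne
  exact Set.disjoint_left.2 fun L' h1 h2 => hne (h1.2.symm.trans h2.2)

theorem cyclicOver_one (L : AddSubgroup ℂ) : cyclicOver 1 L = {L} := by
  ext L'
  constructor
  · rintro ⟨w, rfl, hw⟩
    have : w ∈ L := by simpa using (hw 1).2 (by simp)
    exact sup_eq_left.2 ((AddSubgroup.zmultiples_le).2 this)
  · rintro rfl
    exact ⟨0, by simp, fun n => by simp⟩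

theorem finsum_cyclicOver_prime_const {L : AddSubgroup ℂ} (hL : IsPeriodLattice L) {p : ℕ}
    (hp : p.Prime) (c : ℝ) : ∑ᶠ _L' ∈ cyclicOver p L, c = (p + 1) * c := by
  obtain ⟨u, v, h, rfl⟩ := hL
  rw [finsum_cyclicOver_prime h hp fun _ => c]
  simp
  ring

-- The sum is regrouped along `L₁ ↦ L + p L₁`, whose fibres have `p + 1` elements, or `p` if `p ∣
-- M`.
open Pointwise in
theorem finsum_sup_smul {p M : ℕ} (hp : p.Prime) (hM : 0 < M) {L : AddSubgroup ℂ}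
    (hL : IsPeriodLattice L) (hfin : (cyclicOver M L).Finite) (f : AddSubgroup ℂ → ℝ) :
    ∑ᶠ L₁ ∈ cyclicOver (p * M) L, f (L ⊔ (p : ℂ) • L₁) =
      (p + 1 - if p ∣ M then 1 else 0) * ∑ᶠ L₀ ∈ cyclicOver M L, f L₀ := by
  rw [finsum_cyclicOver_mul hp hM hL hfin, mul_finsum_mem]
  refine finsum_mem_congr rfl fun L₀ h₀ => ?_
  rw [finsum_mem_congr (g := fun _ => f L₀) rfl fun L₁ h₁ => by rw [h₁.2],
    finsum_cyclicFiber hp hM hL h₀ (f := fun _ => f L₀) (fun _ _ _ _ => rfl),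
    finsum_cyclicOver_prime_const (hL.of_mem_cyclicOver hM h₀) hp]
  split_ifs <;> ring

/-! ### Recursions for `e_N` and `λ_N`. -/

theorem eN_one : eN 1 = 1 := by simp [eN]

theorem eN_mul_of_not_dvd {p M : ℕ} (hp : p.Prime) (hM : 0 < M) (h : ¬ p ∣ M) :
    eN (p * M) = (p + 1) * eN M := by
  have hp0 : (p : ℝ) ≠ 0 := by exact_mod_cast hp.ne_zero
  have : p ∉ M.primeFactors := fun h' => h (Nat.dvd_of_mem_primeFactors h')
  rw [eN, eN, Nat.primeFactors_mul hp.ne_zero hM.ne', hp.primeFactors, Finset.singleton_union,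
    Finset.prod_insert this]
  push_cast
  field_simp

theorem eN_mul_of_dvd {p M : ℕ} (hp : p.Prime) (hM : 0 < M) (h : p ∣ M) :
    eN (p * M) = p * eN M := by
  have : p ∈ M.primeFactors := Nat.mem_primeFactors.2 ⟨hp, h, hM.ne'⟩
  rw [eN, eN, Nat.primeFactors_mul hp.ne_zero hM.ne', hp.primeFactors, Finset.singleton_union,
    Finset.insert_eq_of_mem this]
  push_cast
  ring

theorem eN_pos {N : ℕ} (hN : 0 < N) : 0 < eN N := by
  unfold eN
  positivity

/-- The term of `lambdaN` at a prime, extended by `0` to exponent `0`. -/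
noncomputable def lambdaTerm (p r : ℕ) : ℝ :=
  ((p : ℝ) ^ r - 1) / ((p : ℝ) ^ (r - 1) * ((p : ℝ) ^ 2 - 1)) * Real.log p

/-- The term is the geometric sum of `log p / (p ^ i (p + 1))` over `i < r`. -/
theorem lambdaTerm_succ {p : ℕ} (hp : p.Prime) (r : ℕ) :
    lambdaTerm p (r + 1) = lambdaTerm p r + Real.log p / ((p : ℝ) ^ r * (p + 1)) := by
  have hp0 : (p : ℝ) ≠ 0 := by exact_mod_cast hp.ne_zero
  have hp1 : (1 : ℝ) < p := by exact_mod_cast hp.one_lt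
  have h1 : (p : ℝ) ^ 2 - 1 ≠ 0 := by nlinarith
  have h2 : (p : ℝ) + 1 ≠ 0 := by linarith
  have h3 : (p : ℝ) - 1 ≠ 0 := by linarith
  have h4 : (p : ℝ) ^ 2 - 1 = (p - 1) * (p + 1) := by ring
  unfold lambdaTerm
  rw [h4]
  cases r with
  | zero => simp; field_simp
  | succ r =>
    simp only [Nat.add_sub_cancel]
    field_simp
    ring

theorem lambdaN_eq_sum {N : ℕ} {s : Finset ℕ} (hs : N.primeFactors ⊆ s) :
    lambdaN N = ∑ q ∈ s, lambdaTerm q (N.factorization q) := by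
  refine Finset.sum_subset hs fun q _ hq => ?_
  rw [← Nat.support_factorization, Finsupp.notMem_support_iff] at hq
  simp [hq]

theorem lambdaN_mul {p M : ℕ} (hp : p.Prime) (hM : 0 < M) :
    lambdaN (p * M) =
      lambdaN M + Real.log p / ((p : ℝ) ^ M.factorization p * (p + 1)) := by
  have hs := Nat.primeFactors_mul hp.ne_zero hM.ne'
  rw [hp.primeFactors, Finset.singleton_union] at hs
  rw [lambdaN_eq_sum (s := insert p M.primeFactors) hs.le,
    lambdaN_eq_sum (s := insert p M.primeFactors) (Finset.subset_insert _ _),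
    ← Finset.add_sum_erase _ _ (Finset.mem_insert_self p _),
    ← Finset.add_sum_erase _ (fun q => lambdaTerm q (M.factorization q))
      (Finset.mem_insert_self p _),
    Nat.factorization_mul hp.ne_zero hM.ne', hp.factorization]
  have h1 : ∀ q ∈ (insert p M.primeFactors).erase p,
      lambdaTerm q ((Finsupp.single p 1 + M.factorization : ℕ →₀ ℕ) q) =
        lambdaTerm q (M.factorization q) := by
    intro q hq
    have : p ≠ q := (Finset.ne_of_mem_erase hq).symm
    rw [Finsupp.add_apply, Finsupp.single_eq_of_ne this.symm, zero_add]
  rw [Finset.sum_congr rfl h1, Finsupp.add_apply, Finsupp.single_eq_same, add_comm 1,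
    lambdaTerm_succ hp]
  ring

/-- The value of the averaged isogeny constant for `log ‖Δ‖`. -/
noncomputable def heckeConst (N : ℕ) : ℝ := -6 * Real.log N + 12 * lambdaN N

theorem heckeConst_one : heckeConst 1 = 0 := by simp [heckeConst, lambdaN]

theorem heckeConst_mul {p M : ℕ} (hp : p.Prime) (hM : 0 < M) :
    heckeConst (p * M) = heckeConst M - 6 * Real.log p +
      12 * (Real.log p / ((p : ℝ) ^ M.factorization p * (p + 1))) := by
  have hp0 : (p : ℝ) ≠ 0 := by exact_mod_cast hp.ne_zero
  have hM0 : (M : ℝ) ≠ 0 := by exact_mod_cast hM.ne'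
  rw [heckeConst, heckeConst, lambdaN_mul hp hM]
  push_cast
  rw [Real.log_mul hp0 hM0]
  ring

/-! ### Induction on the order `N`. -/

open Pointwise in
/-- A homothety-invariant function on lattices whose sum over the extensions of prime degree `p`
is `(p + 1) f + t c_p` has a similar sum over the cyclic extensions of any order. -/
theorem finsum_cyclicOver_of_card {f : AddSubgroup ℂ → ℝ} {t : ℝ} {L : AddSubgroup ℂ}
    (hL : IsPeriodLattice L)
    (hf : ∀ L : AddSubgroup ℂ, IsPeriodLattice L → ∀ c : ℂ, c ≠ 0 → f (c • L) = f L)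
    (hprime : ∀ L : AddSubgroup ℂ, IsPeriodLattice L → ∀ p : ℕ, p.Prime →
      ∑ᶠ L' ∈ cyclicOver p L, f L' = (p + 1) * f L + t * (6 * (1 - p) * Real.log p))
    (hcount : t ≠ 0 → ∀ M : ℕ, 0 < M → ∑ᶠ _L' ∈ cyclicOver M L, (1 : ℝ) = eN M)
    {N : ℕ} (hN : 0 < N) : (cyclicOver N L).Finite ∧
      ∑ᶠ L' ∈ cyclicOver N L, f L' = eN N * (f L + t * heckeConst N) := by
  induction N using Nat.strong_induction_on with
  | _ N ih =>
  rcases eq_or_ne N 1 with rfl | hN1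
  · rw [cyclicOver_one, finsum_mem_singleton, eN_one, heckeConst_one]
    exact ⟨Set.finite_singleton _, by ring⟩
  obtain ⟨p, hp, M, rfl⟩ : ∃ p, p.Prime ∧ ∃ M, N = p * M := Nat.exists_prime_and_dvd hN1
  have hM : 0 < M := Nat.pos_of_mul_pos_left hN
  have hlt {k : ℕ} (hk : 0 < k) : k < p * k := by nlinarith [hp.two_le]
  obtain ⟨hfin, hsum⟩ := ih M (hlt hM) hM
  refine ⟨cyclicOver_mul_finite hp hM hL hfin, ?_⟩
  have hp0 : (p : ℝ) ≠ 0 := by exact_mod_cast hp.ne_zero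
  have hp1 : (p : ℝ) + 1 ≠ 0 := by positivity
  -- The count is needed only for `t ≠ 0`; thus the induction can first be run with `t = 0`, `f = 1`
  -- to obtain the count itself.
  have hsum1 : t * (6 * (1 - p) * Real.log p) * ∑ᶠ _L₁ ∈ cyclicOver M L, (1 : ℝ) =
      t * (6 * (1 - p) * Real.log p) * eN M := by
    rcases eq_or_ne t 0 with rfl | ht
    · simp
    · rw [hcount ht M hM]
  have key : ∑ᶠ L' ∈ cyclicOver (p * M) L, f L' =
      (p + 1) * ∑ᶠ L₁ ∈ cyclicOver M L, f L₁ +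
        t * (6 * (1 - p) * Real.log p) * eN M -
        ∑ᶠ L₁ ∈ cyclicOver M L, if p ∣ M then f (L ⊔ (p : ℂ) • L₁) else 0 := by
    rw [finsum_cyclicOver_mul hp hM hL hfin, ← hsum1, mul_finsum_mem, mul_finsum_mem,
      ← finsum_mem_add_distrib hfin, ← finsum_mem_sub_distrib _ _ hfin]
    refine finsum_mem_congr rfl fun L₁ h₁ => ?_
    rw [finsum_cyclicFiber hp hM hL h₁ hf, hprime L₁ (hL.of_mem_cyclicOver hM h₁) p hp, mul_one]
  rw [key, hsum, heckeConst_mul hp hM]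
  by_cases hpM : p ∣ M
  · simp only [if_pos hpM]
    obtain ⟨M', rfl⟩ := hpM
    have hM' : 0 < M' := Nat.pos_of_mul_pos_left hM
    -- The correction terms `f (L + p L₁)` live over order `M' = M / p`, so the recursion reaches
    -- back two steps; the multiplicity depends on whether `p ∣ M'`.
    obtain ⟨hfin', hsum'⟩ := ih M' ((hlt hM').trans (hlt hM)) hM'
    rw [finsum_sup_smul hp hM' hL hfin', hsum', heckeConst_mul hp hM',
      eN_mul_of_dvd hp hM (dvd_mul_right p M'), Nat.factorization_mul hp.ne_zero hM'.ne',
      hp.factorization, Finsupp.add_apply, Finsupp.single_eq_same, pow_add, pow_one]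
    by_cases hpM' : p ∣ M'
    · rw [if_pos hpM', eN_mul_of_dvd hp hM' hpM']
      field_simp
      ring
    · rw [if_neg hpM', eN_mul_of_not_dvd hp hM' hpM', Nat.factorization_eq_zero_of_not_dvd hpM']
      field_simp
      ring
  · simp only [if_neg hpM, finsum_zero, eN_mul_of_not_dvd hp hM hpM,
      Nat.factorization_eq_zero_of_not_dvd hpM]
    field_simp
    ring

theorem cyclicOver_finite {N : ℕ} (hN : 0 < N) {L : AddSubgroup ℂ} (hL : IsPeriodLattice L) :
    (cyclicOver N L).Finite ∧ ∑ᶠ _L' ∈ cyclicOver N L, (1 : ℝ) = eN N := by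
  have := finsum_cyclicOver_of_card (f := fun _ => 1) (t := 0) hL (fun _ _ _ _ => rfl)
    (fun L hL p hp => by rw [finsum_cyclicOver_prime_const hL hp, zero_mul, add_zero])
    (fun h => absurd rfl h) hN
  simpa using this

theorem finsum_log_latticeDelta {N : ℕ} (hN : 0 < N) {L : AddSubgroup ℂ}
    (hL : IsPeriodLattice L) : ∑ᶠ L' ∈ cyclicOver N L, Real.log (latticeDelta L') =
      eN N * (Real.log (latticeDelta L) + heckeConst N) := by
  have := finsum_cyclicOver_of_card (f := fun L => Real.log (latticeDelta L)) (t := 1) hL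
    (fun L hL c hc => by rw [latticeDelta_smul hL hc])
    (fun L hL p hp => by rw [finsum_log_latticeDelta_prime hL hp, one_mul])
    (fun _ M hM => (cyclicOver_finite hM hL).2) hN
  simpa using this.2

/-! ### Uniformizations and independence of the period ratio. -/

/-- A holomorphic universal covering of `Y` by `ℂ` whose deck transformations are the translations
by elements of `L`. -/
structure IsUniformization {Y : Type*} [TopologicalSpace Y] [ChartedSpace ℂ Y]
    (L : AddSubgroup ℂ) (π : ℂ → Y) : Prop where
  isCoveringMap : IsCoveringMap π
  holomorphic : MDifferentiable 𝓘(ℂ) 𝓘(ℂ) π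
  surjective : Function.Surjective π
  eq_iff : ∀ z w : ℂ, π z = π w ↔ z - w ∈ L
  differentiable_of_comp : ∀ f : ℂ → ℂ, Continuous f → MDifferentiable 𝓘(ℂ) 𝓘(ℂ) (π ∘ f) →
    Differentiable ℂ f

/-- Every complex number is congruent modulo `ℤ + τ ℤ` to a point of a fundamental
parallelogram. -/
theorem exists_add_mem_parallelogram (τ : UpperHalfPlane) (z : ℂ) :
    ∃ m n : ℤ, ∃ s ∈ Set.Icc (0 : ℝ) 1, ∃ t ∈ Set.Icc (0 : ℝ) 1,
      z = ((s : ℂ) + t * τ) + (m + n * τ) := by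
  have hτ : τ.im ≠ 0 := τ.im_pos.ne'
  set y : ℝ := z.im / τ.im with hy
  set x : ℝ := z.re - y * τ.re with hx
  refine ⟨⌊x⌋, ⌊y⌋, Int.fract x, ⟨Int.fract_nonneg _, (Int.fract_lt_one _).le⟩, Int.fract y,
    ⟨Int.fract_nonneg _, (Int.fract_lt_one _).le⟩, ?_⟩
  have h1 : ((Int.fract x : ℝ) : ℂ) + ⌊x⌋ = x := by exact_mod_cast Int.fract_add_floor x
  have h2 : ((Int.fract y : ℝ) : ℂ) + ⌊y⌋ = y := by exact_mod_cast Int.fract_add_floor y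
  have h3 : z = x + y * τ := by
    apply Complex.ext
    · simp [hx]
    · simp [hy]
      field_simp
  linear_combination h3 - h1 - τ * h2

/-- An entire function that is doubly periodic is constant. -/
theorem eq_of_doubly_periodic {g : ℂ → ℂ} (hg : Differentiable ℂ g) (τ : UpperHalfPlane)
    (hper : ∀ (z : ℂ) (m n : ℤ), g (z + (m + n * τ)) = g z) (z w : ℂ) : g z = g w := by
  refine hg.apply_eq_apply_of_bounded ?_ z w
  have hK : IsCompact ((fun p : ℝ × ℝ => g ((p.1 : ℂ) + p.2 * τ)) ''
      (Set.Icc (0 : ℝ) 1 ×ˢ Set.Icc (0 : ℝ) 1)) := by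
    refine (isCompact_Icc.prod isCompact_Icc).image ?_
    have := hg.continuous
    fun_prop
  refine hK.isBounded.subset ?_
  rintro _ ⟨z, rfl⟩
  obtain ⟨m, n, s, hs, t, ht, hz⟩ := exists_add_mem_parallelogram τ z
  exact ⟨(s, t), ⟨hs, ht⟩, by rw [hz, hper]⟩

section

variable {Y : Type*} [TopologicalSpace Y] [ChartedSpace ℂ Y]

/-- A parametrization of `Y` by a torus factors through the uniformization by a linear map. -/
theorem IsUniformization.exists_linear {L : AddSubgroup ℂ} {π : ℂ → Y} (h : IsUniformization L π)
    {τ : UpperHalfPlane} {π' : ℂ → Y} (h' : IsTorusParametrization τ π') :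
    ∃ a : ℂ, ∀ z w, π' z = π' w ↔ a * (z - w) ∈ L := by
  have hcont : Continuous π' := h'.holomorphic.continuous
  obtain ⟨e₀, he₀⟩ := h.surjective (π' 0)
  obtain ⟨F, ⟨-, hF⟩, -⟩ :=
    h.isCoveringMap.existsUnique_continuousMap_lifts ⟨π', hcont⟩ 0 e₀ he₀
  have hF' (z : ℂ) : π (F z) = π' z := congrFun hF z
  have hFd : Differentiable ℂ F := by
    refine h.differentiable_of_comp F F.continuous ?_
    rw [hF]
    exact h'.holomorphic
  -- Both sides are lifts of `π'` through `π` that agree at `0`, so translation by a period changes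
  -- `F` by a constant and `deriv F` is doubly periodic.
  have hper (m n : ℤ) (z : ℂ) :
      F (z + (m + n * τ)) = F z + (F (0 + (m + n * τ)) - F 0) := by
    have hπ (z : ℂ) : π' (z + (m + n * τ)) = π' z :=
      (h'.eq_iff _ _).2 ⟨m, n, by ring⟩
    have hmem : F (0 + (m + n * τ)) - F 0 ∈ L := by
      rw [← h.eq_iff, hF', hF', hπ]
    have := h.isCoveringMap.eq_of_comp_eq (g₁ := fun z => F (z + (m + n * τ)))
      (g₂ := fun z => F z + (F (0 + (m + n * τ)) - F 0)) (by fun_prop) (by fun_prop) (by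
        funext z
        change π (F _) = π _
        rw [hF', hπ, ← hF', h.eq_iff]
        simpa using L.neg_mem hmem) 0 (by ring)
    exact congrFun this z
  have hconst : ∀ z w, deriv F z = deriv F w := by
    refine eq_of_doubly_periodic (hFd.contDiff (n := 2)).differentiable_deriv_two τ ?_
    intro z m n
    rw [← deriv_comp_add_const]
    have : (fun x => F (x + (m + n * τ))) = fun x => F x + (F (0 + (m + n * τ)) - F 0) :=
      funext (hper m n)
    rw [this, deriv_add_const]
  set a := deriv F 0 with ha
  have hlin : ∀ z w, F z - a * z = F w - a * w := by
    refine is_const_of_deriv_eq_zero (f := fun z => F z - a * z) (by fun_prop) fun z => ?_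
    rw [deriv_fun_sub (hFd z) (by fun_prop), hconst z 0]
    simp [ha]
  refine ⟨a, fun z w => ?_⟩
  rw [← hF', ← hF', h.eq_iff]
  have : F z - F w = a * (z - w) := by linear_combination hlin z w
  rw [this]

/-- Rescaling by `v` normalizes the lattice; this rules out the default value `0` of `normDelta`. -/
theorem IsUniformization.exists_isTorusParametrization {L : AddSubgroup ℂ} {π : ℂ → Y}
    (h : IsUniformization L π) (hL : IsPeriodLattice L) :
    ∃ τ : UpperHalfPlane, ∃ π' : ℂ → Y, IsTorusParametrization τ π' := by
  obtain ⟨u, v, hA, rfl⟩ := hL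
  have hv := right_ne_zero_of_area hA
  refine ⟨⟨u / v, im_div_pos hA⟩, fun z => π (v * z), ?_, ?_, fun z w => ?_⟩
  · refine h.holomorphic.comp (f := fun z => v * z) ?_
    rw [mdifferentiable_iff_differentiable]
    fun_prop
  · intro y
    obtain ⟨z, rfl⟩ := h.surjective y
    exact ⟨z / v, congrArg π (mul_div_cancel₀ _ hv)⟩
  · rw [h.eq_iff, mem_periodLattice]
    constructor
    · rintro ⟨m, n, hmn⟩
      refine ⟨n, m, ?_⟩
      simp only
      field_simp
      linear_combination -hmn
    · rintro ⟨m, n, hmn⟩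
      refine ⟨n, m, ?_⟩
      simp only at hmn
      rw [← mul_sub, hmn]
      field_simp
      ring

open Pointwise in
/-- The invariant `‖Δ‖` of a Riemann surface uniformized by `ℂ` with period lattice `L`. -/
theorem IsUniformization.normDelta_eq [IsManifold 𝓘(ℂ) ω Y] {L : AddSubgroup ℂ} {π : ℂ → Y}
    (h : IsUniformization L π) (hL : IsPeriodLattice L) : normDelta Y = latticeDelta L := by
  have hex := h.exists_isTorusParametrization hL
  rw [normDelta, dif_pos hex]
  generalize hτ : hex.choose = τ
  obtain ⟨π', h'⟩ : ∃ π' : ℂ → Y, IsTorusParametrization τ π' := hτ ▸ hex.choose_spec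
  obtain ⟨a, ha⟩ := h.exists_linear h'
  have hA : 0 < orientedArea (τ : ℂ) 1 := by simpa [orientedArea] using τ.im_pos
  have hmem (z : ℂ) : a * z ∈ L ↔ z ∈ periodLattice τ 1 := by
    have h1 := ha z 0
    rw [sub_zero, h'.eq_iff, sub_zero] at h1
    rw [← h1, mem_periodLattice]
    constructor
    · rintro ⟨m, n, rfl⟩
      exact ⟨n, m, by ring⟩
    · rintro ⟨m, n, rfl⟩
      exact ⟨n, m, by ring⟩
  -- With `a = 0` every complex number would be a period, but `τ / 2` is not.
  have ha0 : a ≠ 0 := by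
    rintro rfl
    have h1 : (((1 / 2 : ℝ) : ℂ) * τ + ((0 : ℝ) : ℂ) * 1) ∈ periodLattice (τ : ℂ) 1 := by
      rw [← hmem, zero_mul]
      exact zero_mem _
    rw [comb_mem_periodLattice_iff hA] at h1
    obtain ⟨m, hm⟩ := h1.1
    have : (2 * m : ℤ) = 1 := by
      have : (2 * m : ℝ) = 1 := by rw [hm]; norm_num
      exact_mod_cast this
    omega
  have hLa : L = a • periodLattice τ 1 := by
    ext x
    rw [AddSubgroup.mem_smul_pointwise_iff_exists]
    constructor
    · intro hx
      refine ⟨x / a, ?_, mul_div_cancel₀ _ ha0⟩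
      rwa [← hmem, mul_div_cancel₀ _ ha0]
    · rintro ⟨s, hs, rfl⟩
      exact (hmem s).2 hs
  rw [hLa, latticeDelta_smul ⟨_, _, hA, rfl⟩ ha0, latticeDelta_periodLattice hA, div_one]
  rfl

end

/-! ### Logarithm and exponential of a one-dimensional complex Lie group. -/

open Filter Topology in
/-- A one-dimensional analytic local group law has a logarithm. -/
theorem exists_local_log {F : ℂ × ℂ → ℂ} {c : ℂ} (hF : ContDiffAt ℂ ω F (c, c))
    (hl : ∀ᶠ x in 𝓝 c, F (x, c) = x) (hr : ∀ᶠ x in 𝓝 c, F (c, x) = x)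
    (ha : ∀ᶠ q : ℂ × ℂ × ℂ in 𝓝 (c, c, c),
      F (F (q.1, q.2.1), q.2.2) = F (q.1, F (q.2.1, q.2.2))) :
    ∃ l : ℂ → ℂ, HasStrictDerivAt l 1 c ∧ l c = 0 ∧
      ∀ᶠ q : ℂ × ℂ in 𝓝 (c, c), l (F q) = l q.1 + l q.2 := by
  have hcc : F (c, c) = c := hl.self_of_nhds
  have hFc : Tendsto F (𝓝 (c, c)) (𝓝 c) := by
    simpa [hcc, ContinuousAt] using hF.continuousAt
  have hFd : ∀ᶠ q in 𝓝 (c, c), ContDiffAt ℂ ω F q := hF.eventually (by simp)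
  have hcy : Tendsto (fun y : ℂ => (c, y)) (𝓝 c) (𝓝 (c, c)) := by
    have : Continuous fun y : ℂ => (c, y) := by fun_prop
    exact this.tendsto c
  have hslice {x y : ℂ} (h : ContDiffAt ℂ ω F (x, y)) :
      HasDerivAt (fun s => F (s, y)) (fderiv ℂ F (x, y) (1, 0)) x := by
    have h1 := (h.differentiableAt (by simp)).hasFDerivAt
    have h2 : HasDerivAt (fun s : ℂ => (s, y)) ((1 : ℂ), (0 : ℂ)) x :=
      (hasDerivAt_id x).prodMk (hasDerivAt_const x y)
    exact h1.comp_hasDerivAt x h2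
  -- `G` is the coefficient of the invariant vector field, so `dy / G(y)` is the invariant
  -- differential.
  set G : ℂ → ℂ := fun y => fderiv ℂ F (c, y) (1, 0) with hG
  have hGd : ∀ᶠ y in 𝓝 c, DifferentiableAt ℂ G y := by
    filter_upwards [hcy.eventually hFd] with y hy
    have h1 : DifferentiableAt ℂ (fderiv ℂ F) (c, y) :=
      (hy.fderiv_right (m := 1) (by exact le_top)).differentiableAt (by simp)
    have h2 : DifferentiableAt ℂ (fun y : ℂ => (c, y)) y := by fun_prop
    exact (h1.comp y h2).clm_apply (differentiableAt_const _)
  have hGc : G c = 1 := by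
    have h1 : HasDerivAt (fun s => F (s, c)) 1 c :=
      (hasDerivAt_id c).congr_of_eventuallyEq hl
    exact (hslice hF).unique h1
  have hGne : ∀ᶠ y in 𝓝 c, G y ≠ 0 :=
    hGd.self_of_nhds.continuousAt.eventually_ne (by rw [hGc]; exact one_ne_zero)
  -- Differentiate `F(F(s, x), y) = F(s, F(x, y))` in `s` at `s = c`.
  have hkey : ∀ᶠ q : ℂ × ℂ in 𝓝 (c, c), fderiv ℂ F q (1, 0) * G q.1 = G (F q) := by
    have h1 : Tendsto (fun q : ℂ × ℂ => (c, q)) (𝓝 (c, c)) (𝓝 (c, c, c)) := by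
      have : Continuous fun q : ℂ × ℂ => (c, q) := by fun_prop
      exact this.tendsto (c, c)
    have h2 : Tendsto (fun q : ℂ × ℂ => (c, q.1)) (𝓝 (c, c)) (𝓝 (c, c)) := by
      have : Continuous fun q : ℂ × ℂ => (c, q.1) := by fun_prop
      exact this.tendsto (c, c)
    have h3 : Tendsto (fun q : ℂ × ℂ => (c, F q)) (𝓝 (c, c)) (𝓝 (c, c)) :=
      (hcy.comp hFc)
    have h4 : ∀ᶠ q : ℂ × ℂ in 𝓝 (c, c), F (c, q.1) = q.1 :=
      (continuous_fst.tendsto (c, c)).eventually hr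
    filter_upwards [h1.eventually ha.eventually_nhds, hFd, h2.eventually hFd, h3.eventually hFd,
      h4] with ⟨x, y⟩ hass hd1 hd2 hd3 hx
    simp only at hx hd2
    have h5 : Tendsto (fun s : ℂ => (s, x, y)) (𝓝 c) (𝓝 (c, x, y)) := by
      have : Continuous fun s : ℂ => (s, x, y) := by fun_prop
      exact this.tendsto c
    have h6 : HasDerivAt (fun s => F (F (s, x), y)) (fderiv ℂ F (x, y) (1, 0) * G x) c := by
      have h7 := hslice hd1
      rw [← hx] at h7
      have := HasDerivAt.comp c h7 (hslice hd2)
      rw [hx] at this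
      exact this
    exact (h6.congr_of_eventuallyEq ((h5.eventually hass).mono fun s hs => hs.symm)).unique
      (hslice hd3)
  obtain ⟨r, hr0, hrball⟩ := Metric.eventually_nhds_iff_ball.1 (hGd.and hGne)
  have hinv : DifferentiableOn ℂ (fun y => (G y)⁻¹) (Metric.ball c r) := fun y hy =>
    ((hrball y hy).1.inv (hrball y hy).2).differentiableWithinAt
  obtain ⟨l, hlc, hld⟩ := hinv.isExactOn_ball.with_val_at c 0
  refine ⟨l, ?_, hlc, ?_⟩
  · have h1 : AnalyticAt ℂ l c := DifferentiableOn.analyticAt (s := Metric.ball c r)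
      (fun z hz => (hld z hz).differentiableAt.differentiableWithinAt) (Metric.ball_mem_nhds c hr0)
    have h2 := h1.hasStrictDerivAt
    rwa [(hld c (Metric.mem_ball_self hr0)).deriv, hGc, inv_one] at h2
  · obtain ⟨r', hr'0, hr'⟩ := Metric.eventually_nhds_iff_ball.1
      ((hkey.and (hFc.eventually (Metric.ball_mem_nhds c hr0))).and
        (hFd.and ((continuous_snd.tendsto (c, c)).eventually hr)))
    set ρ := min r r' with hρ
    have hρ0 : 0 < ρ := lt_min hr0 hr'0
    have hmem {x y : ℂ} (hx : x ∈ Metric.ball c ρ) (hy : y ∈ Metric.ball c ρ) :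
        (x, y) ∈ Metric.ball (c, c) r' := by
      rw [← ball_prod_same]
      exact ⟨Metric.ball_subset_ball (min_le_right _ _) hx,
        Metric.ball_subset_ball (min_le_right _ _) hy⟩
    refine Metric.eventually_nhds_iff_ball.2 ⟨ρ, hρ0, ?_⟩
    rintro ⟨x, y⟩ hxy
    rw [← ball_prod_same] at hxy
    obtain ⟨hx, hy⟩ := hxy
    simp only at hx hy
    have hderiv : ∀ z ∈ Metric.ball c ρ, HasDerivAt (fun z => l (F (z, y)) - l z) 0 z := by
      intro z hz
      obtain ⟨⟨h1, h2⟩, h3, -⟩ := hr' (z, y) (hmem hz hy)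
      have hz' := Metric.ball_subset_ball (min_le_left r r') hz
      have h4 := (HasDerivAt.comp z (hld _ h2) (hslice h3)).sub (hld z hz')
      have h5 : (G (F (z, y)))⁻¹ * fderiv ℂ F (z, y) (1, 0) - (G z)⁻¹ = 0 := by
        have e1 := (hrball _ h2).2
        have e2 := (hrball _ hz').2
        simp only at h1
        field_simp
        linear_combination h1
      rw [h5] at h4
      exact h4
    -- For fixed `y` the difference `l (F (z, y)) - l z` is constant in `z`; its value at `z = c` is
    -- `l y`.
    have hconst := Metric.isOpen_ball.is_const_of_fderiv_eq_zero
      (convex_ball c ρ).isPreconnected (f := fun z => l (F (z, y)) - l z)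
      (fun z hz => (hderiv z hz).differentiableAt.differentiableWithinAt)
      (fun z hz => by
        rw [← toSpanSingleton_deriv, (hderiv z hz).deriv]
        simp) hx (Metric.mem_ball_self hρ0)
    have hcy' := (hr' (c, y) (hmem (Metric.mem_ball_self hρ0) hy)).2.2
    simp only at hconst hcy'
    rw [hcy', hlc] at hconst
    linear_combination hconst

/-- A local homomorphism from a disc to a commutative group extends to the plane. -/
theorem exists_addMonoidHom_extension {X : Type*} [AddCommGroup X] {e : ℂ → X} {r : ℝ}
    (hr : 0 < r) (he : ∀ s t : ℂ, ‖s‖ < r → ‖t‖ < r → e (s + t) = e s + e t) :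
    ∃ E : ℂ →+ X, ∀ z : ℂ, ‖z‖ < r → E z = e z := by
  have hex (z : ℂ) : ∃ k : ℕ, ‖z‖ < 2 ^ k * r := by
    obtain ⟨k, hk⟩ := pow_unbounded_of_one_lt (‖z‖ / r) (one_lt_two)
    exact ⟨k, (div_lt_iff₀ hr).1 hk⟩
  have hnorm {z : ℂ} {k : ℕ} (h : ‖z‖ < 2 ^ k * r) : ‖z / 2 ^ k‖ < r := by
    rw [norm_div, norm_pow, Complex.norm_ofNat, div_lt_iff₀ (by positivity)]
    linarith
  have hmono {z : ℂ} {k : ℕ} (h : ‖z‖ < 2 ^ k * r) (j : ℕ) : ‖z‖ < 2 ^ (k + j) * r := by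
    refine h.trans_le (mul_le_mul_of_nonneg_right ?_ hr.le)
    exact pow_le_pow_right₀ one_le_two (Nat.le_add_right k j)
  -- The extension is `2 ^ k • e (z / 2 ^ k)` for any large `k`; doubling inside the disc shows that
  -- `k` does not matter.
  have hstep {z : ℂ} {k : ℕ} (h : ‖z‖ < 2 ^ k * r) (j : ℕ) :
      2 ^ (k + j) • e (z / 2 ^ (k + j)) = 2 ^ k • e (z / 2 ^ k) := by
    induction j with
    | zero => rfl
    | succ j ih =>
      have h1 := hnorm (hmono h (j + 1))
      have h2 := he _ _ h1 h1
      rw [← ih, ← add_assoc, pow_succ (2 : ℕ), mul_smul, two_smul, add_assoc k j 1, ← h2]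
      congr 2
      rw [← add_assoc, pow_succ]
      field_simp
      norm_num
  choose κ hκ using hex
  have hval {z : ℂ} {k : ℕ} (h : ‖z‖ < 2 ^ k * r) :
      2 ^ κ z • e (z / 2 ^ κ z) = 2 ^ k • e (z / 2 ^ k) := by
    rw [← hstep h (κ z), ← hstep (hκ z) k, add_comm]
  refine ⟨AddMonoidHom.mk' (fun z => 2 ^ κ z • e (z / 2 ^ κ z)) fun z w => ?_, fun z hz => ?_⟩
  · set k := κ z + κ w + κ (z + w) with hk
    have hz : ‖z‖ < 2 ^ k * r := by
      rw [hk, add_assoc]; exact hmono (hκ z) _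
    have hw : ‖w‖ < 2 ^ k * r := by
      rw [hk, add_comm (κ z), add_assoc]; exact hmono (hκ w) _
    have hzw : ‖z + w‖ < 2 ^ k * r := by
      rw [hk, add_comm (κ z + κ w)]; exact hmono (hκ (z + w)) _
    rw [hval hz, hval hw, hval hzw, add_div, he _ _ (hnorm hz) (hnorm hw), smul_add]
  · have : ‖z‖ < 2 ^ 0 * r := by simpa using hz
    simpa using hval this

open Filter Topology in
/-- The local logarithm and exponential of a commutative one-dimensional complex Lie group. -/
theorem exists_local_exp (X : Type*) [AddCommGroup X] [TopologicalSpace X] [ChartedSpace ℂ X]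
    [LieAddGroup 𝓘(ℂ) ω X] : ∃ (l : X → ℂ) (e : ℂ → X), l 0 = 0 ∧ e 0 = 0 ∧
      MDifferentiableAt 𝓘(ℂ) 𝓘(ℂ) l 0 ∧ MDifferentiableAt 𝓘(ℂ) 𝓘(ℂ) e 0 ∧
      (∀ᶠ x in 𝓝 0, e (l x) = x) ∧ (∀ᶠ z in 𝓝 0, l (e z) = z) ∧
      ∀ᶠ q : X × X in 𝓝 (0, 0), l (q.1 + q.2) = l q.1 + l q.2 := by
  have : IsTopologicalAddGroup X := topologicalAddGroup_of_lieAddGroup 𝓘(ℂ) ω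
  set φ := chartAt ℂ (0 : X) with hφ
  set c := φ 0 with hc
  have h0s : (0 : X) ∈ φ.source := mem_chart_source ℂ 0
  have hct : c ∈ φ.target := φ.map_source h0s
  have hsc : φ.symm c = 0 := φ.left_inv h0s
  have hφs : ContMDiffAt 𝓘(ℂ) 𝓘(ℂ) ω φ.symm c :=
    contMDiffAt_symm_of_mem_maximalAtlas (IsManifold.chart_mem_maximalAtlas 0) hct
  have hφm : ContMDiffAt 𝓘(ℂ) 𝓘(ℂ) ω φ 0 :=
    contMDiffAt_of_mem_maximalAtlas (IsManifold.chart_mem_maximalAtlas 0) h0s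
  have hφc : Tendsto φ (𝓝 0) (𝓝 c) := φ.continuousAt h0s
  have hsymc : Tendsto φ.symm (𝓝 c) (𝓝 0) := by
    simpa [ContinuousAt, hsc] using φ.symm.continuousAt hct
  set F : ℂ × ℂ → ℂ := fun q => φ (φ.symm q.1 + φ.symm q.2) with hFdef
  have hF : ContDiffAt ℂ ω F (c, c) := by
    rw [← contMDiffAt_iff_contDiffAt]
    have h1 : ContMDiffAt 𝓘(ℂ, ℂ × ℂ) 𝓘(ℂ) ω (fun q : ℂ × ℂ => φ.symm q.1) (c, c) :=
      ContMDiffAt.comp (c, c) (g := φ.symm) (f := Prod.fst) hφs contDiff_fst.contMDiff.contMDiffAt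
    have h2 : ContMDiffAt 𝓘(ℂ, ℂ × ℂ) 𝓘(ℂ) ω (fun q : ℂ × ℂ => φ.symm q.2) (c, c) :=
      ContMDiffAt.comp (c, c) (g := φ.symm) (f := Prod.snd) hφs contDiff_snd.contMDiff.contMDiffAt
    refine ContMDiffAt.comp (c, c) (g := φ) (f := fun q : ℂ × ℂ => φ.symm q.1 + φ.symm q.2)
      ?_ (h1.add h2)
    simp only [hsc, add_zero]
    exact hφm
  have hright : ∀ᶠ x in 𝓝 c, φ (φ.symm x) = x := by
    filter_upwards [φ.open_target.mem_nhds hct] with x hx using φ.right_inv hx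
  have hsource : ∀ᶠ x : X in 𝓝 0, x ∈ φ.source := φ.open_source.mem_nhds h0s
  obtain ⟨l, hld, hlc, hladd⟩ := exists_local_log hF
    (by filter_upwards [hright] with x hx; simp only [F, hsc, add_zero, hx])
    (by filter_upwards [hright] with x hx; simp only [F, hsc, zero_add, hx]) (by
      have t1 : Tendsto (fun q : ℂ × ℂ × ℂ => φ.symm q.1 + φ.symm q.2.1) (𝓝 (c, c, c)) (𝓝 0) := by
        have := (hsymc.comp (continuous_fst.tendsto (c, c, c))).add
          (hsymc.comp ((continuous_fst.comp continuous_snd).tendsto (c, c, c)))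
        simpa using this
      have t2 : Tendsto (fun q : ℂ × ℂ × ℂ => φ.symm q.2.1 + φ.symm q.2.2)
          (𝓝 (c, c, c)) (𝓝 0) := by
        have := (hsymc.comp ((continuous_fst.comp continuous_snd).tendsto (c, c, c))).add
          (hsymc.comp ((continuous_snd.comp continuous_snd).tendsto (c, c, c)))
        simpa using this
      filter_upwards [t1.eventually hsource, t2.eventually hsource] with q h1 h2
      simp only [F]
      rw [φ.left_inv h1, φ.left_inv h2, add_assoc])
  set A : ℂ ≃L[ℂ] ℂ := ContinuousLinearEquiv.unitsEquivAut ℂ (Units.mk0 1 one_ne_zero)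
  have hld' : HasStrictFDerivAt l (A : ℂ →L[ℂ] ℂ) c := hld.hasStrictFDerivAt_equiv one_ne_zero
  set ψ := hld'.localInverse l _ c with hψ
  have hψ0 : ψ 0 = c := by
    have := hld'.localInverse_apply_image
    rwa [hlc] at this
  have hψd : HasStrictFDerivAt ψ (A.symm : ℂ →L[ℂ] ℂ) 0 := by
    have := hld'.to_localInverse
    rwa [hlc] at this
  refine ⟨l ∘ φ, φ.symm ∘ ψ, hlc, ?_, ?_, ?_, ?_, ?_, ?_⟩
  · simp [hψ0, hsc]
  · refine MDifferentiableAt.comp (0 : X) (g := l) (f := φ) ?_ (hφm.mdifferentiableAt (by simp))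
    exact hld.hasDerivAt.differentiableAt.mdifferentiableAt
  · refine MDifferentiableAt.comp (0 : ℂ) (g := φ.symm) (f := ψ) ?_
      hψd.hasFDerivAt.differentiableAt.mdifferentiableAt
    rw [hψ0]
    exact hφs.mdifferentiableAt (by simp)
  · filter_upwards [hφc.eventually hld'.eventually_left_inverse, hsource] with x hx hxs
    simp only [Function.comp]
    rw [hψ, hx, φ.left_inv hxs]
  · have h1 := hld'.eventually_right_inverse
    rw [hlc] at h1
    have h2 : Tendsto ψ (𝓝 0) (𝓝 c) := by
      have := hψd.continuousAt
      rwa [ContinuousAt, hψ0] at this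
    filter_upwards [h1, h2.eventually hright] with z hz hz2
    simp only [Function.comp]
    rw [hz2, hψ, hz]
  · have h1 : Tendsto (fun q : X × X => (φ q.1, φ q.2)) (𝓝 (0, 0)) (𝓝 (c, c)) := by
      rw [nhds_prod_eq, nhds_prod_eq]
      exact hφc.prodMap hφc
    have h2 : ∀ᶠ q : X × X in 𝓝 (0, 0), q.1 ∈ φ.source :=
      (continuous_fst.tendsto ((0 : X), (0 : X))).eventually hsource
    have h3 : ∀ᶠ q : X × X in 𝓝 (0, 0), q.2 ∈ φ.source :=
      (continuous_snd.tendsto ((0 : X), (0 : X))).eventually hsource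
    filter_upwards [h1.eventually hladd, h2, h3] with q hq hq1 hq2
    simp only [F, φ.left_inv hq1, φ.left_inv hq2] at hq
    exact hq

open Filter Topology in
/-- The exponential map of a commutative one-dimensional complex Lie group. -/
theorem exists_exp (X : Type*) [AddCommGroup X] [TopologicalSpace X] [ChartedSpace ℂ X]
    [LieAddGroup 𝓘(ℂ) ω X] : ∃ (E : ℂ →+ X) (l : X → ℂ), MDifferentiable 𝓘(ℂ) 𝓘(ℂ) E ∧
      l 0 = 0 ∧ MDifferentiableAt 𝓘(ℂ) 𝓘(ℂ) l 0 ∧ (∀ᶠ x in 𝓝 0, E (l x) = x) ∧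
      ∀ᶠ z in 𝓝 0, l (E z) = z := by
  have : IsTopologicalAddGroup X := topologicalAddGroup_of_lieAddGroup 𝓘(ℂ) ω
  obtain ⟨l, e, hl0, he0, hld, hed, hel, hle, hadd⟩ := exists_local_exp X
  have hec : Tendsto e (𝓝 0) (𝓝 0) := by
    simpa [ContinuousAt, he0] using hed.continuousAt
  have hlc : Tendsto l (𝓝 0) (𝓝 0) := by
    simpa [ContinuousAt, hl0] using hld.continuousAt
  have hpair : Tendsto (fun q : ℂ × ℂ => (e q.1, e q.2)) (𝓝 (0, 0)) (𝓝 (0, 0)) := by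
    rw [nhds_prod_eq, nhds_prod_eq]
    exact hec.prodMap hec
  have haddX : Tendsto (fun q : X × X => q.1 + q.2) (𝓝 (0, 0)) (𝓝 0) := by
    simpa using (continuous_add (M := X)).tendsto ((0 : X), (0 : X))
  have hloc : ∀ᶠ q : ℂ × ℂ in 𝓝 (0, 0), e (q.1 + q.2) = e q.1 + e q.2 := by
    have h1 : ∀ᶠ q : ℂ × ℂ in 𝓝 (0, 0), l (e q.1) = q.1 :=
      (continuous_fst.tendsto ((0 : ℂ), (0 : ℂ))).eventually hle
    have h2 : ∀ᶠ q : ℂ × ℂ in 𝓝 (0, 0), l (e q.2) = q.2 :=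
      (continuous_snd.tendsto ((0 : ℂ), (0 : ℂ))).eventually hle
    filter_upwards [h1, h2, hpair.eventually hadd, (haddX.comp hpair).eventually hel]
      with q hq1 hq2 hq3 hq4
    simp only [Function.comp] at hq3 hq4
    rw [hq3, hq1, hq2] at hq4
    exact hq4
  obtain ⟨r, hr, hball⟩ := Metric.eventually_nhds_iff_ball.1 hloc
  obtain ⟨E, hE⟩ := exists_addMonoidHom_extension hr (e := e) (fun s t hs ht =>
    hball (s, t) (by rw [← ball_prod_same]; exact ⟨by simpa using hs, by simpa using ht⟩))
  have hEe : ∀ᶠ z in 𝓝 0, E z = e z := by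
    filter_upwards [Metric.ball_mem_nhds (0 : ℂ) hr] with z hz
    exact hE z (by simpa using hz)
  refine ⟨E, l, fun z₀ => ?_, hl0, hld, ?_, ?_⟩
  -- Near `z₀` the homomorphism `E` is `e` conjugated by translations, so holomorphy at `0` spreads
  -- to `z₀`.
  · have h1 : MDifferentiableAt 𝓘(ℂ) 𝓘(ℂ) (fun z => e (z - z₀) + E z₀) z₀ := by
      have h2 : MDifferentiableAt 𝓘(ℂ) 𝓘(ℂ) (fun z : ℂ => z - z₀) z₀ := by
        rw [mdifferentiableAt_iff_differentiableAt]
        fun_prop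
      have h3 : MDifferentiableAt 𝓘(ℂ) 𝓘(ℂ) (fun z => e (z - z₀)) z₀ :=
        MDifferentiableAt.comp z₀ (g := e) (f := fun z : ℂ => z - z₀)
          (by rw [sub_self]; exact hed) h2
      exact MDifferentiableAt.comp z₀ (g := fun x => x + E z₀)
        ((contMDiff_add_right (I := 𝓘(ℂ)) (n := ω)).mdifferentiable (by simp) _) h3
    refine h1.congr_of_eventuallyEq ?_
    have h4 : Tendsto (fun z : ℂ => z - z₀) (𝓝 z₀) (𝓝 0) := by
      have : Continuous fun z : ℂ => z - z₀ := by fun_prop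
      simpa using this.tendsto z₀
    filter_upwards [h4.eventually hEe] with z hz
    rw [← hz, ← map_add, sub_add_cancel]
  · filter_upwards [hlc.eventually hEe, hel] with x hx hx2
    rw [hx, hx2]
  · filter_upwards [hEe, hle] with z hz hz2
    rw [hz, hz2]

/-! ### The kernel of the exponential is a lattice. -/

open Filter Topology in
theorem isDiscrete_of_eventually_eq_zero {L : AddSubgroup ℂ}
    (h : ∀ᶠ z in 𝓝 (0 : ℂ), z ∈ L → z = 0) : IsDiscrete (L : Set ℂ) := by
  refine ⟨discreteTopology_of_isOpen_singleton_zero (G := L) ?_⟩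
  rw [isOpen_iff_mem_nhds]
  rintro _ rfl
  have h1 : ∀ᶠ z : L in 𝓝 (0 : L), (z : ℂ) ∈ L → (z : ℂ) = 0 :=
    (continuous_subtype_val.tendsto (0 : L)).eventually h
  filter_upwards [h1] with z hz
  exact Subtype.ext (hz z.2)

/-- A discrete subgroup that spans `ℂ` over `ℝ` is a lattice. -/
theorem isPeriodLattice_of_isDiscrete {L : AddSubgroup ℂ} (h : IsDiscrete (L : Set ℂ))
    (hspan : Submodule.span ℝ (L : Set ℂ) = ⊤) : IsPeriodLattice L := by
  set M : Submodule ℤ ℂ := AddSubgroup.toIntSubmodule L with hM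
  have hdisc : DiscreteTopology M := h.to_subtype
  have hlat : IsZLattice ℝ M := ⟨hspan⟩
  have hfin : Module.Finite ℤ M := ZLattice.module_finite ℝ M
  have hfree : Module.Free ℤ M := ZLattice.module_free ℝ M
  let b : Module.Basis (Fin 2) ℤ M := Module.finBasisOfFinrankEq ℤ M (by
    rw [ZLattice.rank ℝ, Complex.finrank_real_complex])
  set u : ℂ := (b 0).1 with hu
  set v : ℂ := (b 1).1 with hv
  have huv : L = periodLattice u v := by
    refine le_antisymm (fun x hx => ?_) (periodLattice_le.2 ⟨(b 0).2, (b 1).2⟩)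
    have h1 := b.sum_repr ⟨x, hx⟩
    rw [Fin.sum_univ_two] at h1
    have h2 := congrArg (fun y : M => y.1) h1
    simp only [Submodule.coe_add, Submodule.coe_smul, zsmul_eq_mul] at h2
    exact mem_periodLattice.2 ⟨_, _, h2⟩
  have hli : LinearIndependent ℝ ![u, v] := by
    have := (b.ofZLatticeBasis ℝ M).linearIndependent
    convert! this using 1
    funext i
    fin_cases i <;> simp [hu, hv]
  rw [LinearIndependent.pair_iff] at hli
  -- If the area vanished, `(v.re, -u.re)` and `(v.im, -u.im)` would be real relations between `u`
  -- and `v`, forcing `u = 0`.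
  have hA : orientedArea u v ≠ 0 := by
    intro h0
    rw [orientedArea] at h0
    have h1 := hli v.re (-u.re) (by
      apply Complex.ext
      · simp; ring
      · simp; linear_combination h0)
    have h2 := hli v.im (-u.im) (by
      apply Complex.ext
      · simp; linear_combination -h0
      · simp; ring)
    have hu0 : u = 0 := Complex.ext (by simpa using h1.2) (by simpa using h2.2)
    have := hli 1 0 (by simp [hu0])
    simp at this
  rcases lt_or_gt_of_ne hA with hneg | hpos
  · refine ⟨v, u, ?_, ?_⟩
    · rw [orientedArea] at hneg ⊢
      linarith
    · rw [huv, periodLattice, periodLattice, Set.pair_comm]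
  · exact ⟨u, v, hpos, huv⟩

section

variable {X : Type*} [AddCommGroup X] [TopologicalSpace X]

/-- The kernel of a quotient homomorphism from `ℂ` onto a compact group spans `ℂ`. -/
theorem span_ker_eq_top [CompactSpace X] {E : ℂ →+ X} (hE : Topology.IsQuotientMap E) :
    Submodule.span ℝ (E.ker : Set ℂ) = ⊤ := by
  by_contra hne
  -- A nonzero real functional killing the kernel would descend to a continuous unbounded function
  -- on the compact group `X`.
  obtain ⟨f, hf0, hf⟩ := Submodule.exists_le_ker_of_lt_top _ (lt_top_iff_ne_top.2 hne)
  have hfac (z w : ℂ) (h : E z = E w) : f z = f w := by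
    have : z - w ∈ E.ker := by rw [AddMonoidHom.mem_ker, map_sub, h, sub_self]
    have := hf (Submodule.subset_span this)
    rw [LinearMap.mem_ker, map_sub] at this
    exact sub_eq_zero.1 this
  set g : X → ℝ := fun x => f (Function.surjInv hE.surjective x) with hg
  have hgE : g ∘ E = f := by
    funext z
    exact hfac _ _ (Function.surjInv_eq hE.surjective (E z))
  have hgc : Continuous g := by
    rw [hE.continuous_iff, hgE]
    exact f.continuous_of_finiteDimensional
  obtain ⟨C, hC⟩ := (isCompact_range hgc).isBounded.subset_closedBall (0 : ℝ)
  obtain ⟨z, hz⟩ : ∃ z, f z ≠ 0 := by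
    by_contra! h
    exact hf0 (LinearMap.ext h)
  have h1 : g (E (((C + 1) / f z) • z)) = C + 1 := by
    have := congrFun hgE (((C + 1) / f z) • z)
    simp only [Function.comp] at this
    rw [this, map_smul, smul_eq_mul, div_mul_cancel₀ _ hz]
  have h2 := hC (Set.mem_range_self (E (((C + 1) / f z) • z)))
  rw [h1, mem_closedBall_zero_iff, Real.norm_eq_abs] at h2
  linarith [le_abs_self (C + 1)]

open Filter Topology in
/-- A continuous homomorphism from `ℂ` to a connected group that is open at `0` is a quotient
map. -/
theorem isQuotientMap_of_nhds_le [IsTopologicalAddGroup X] [ConnectedSpace X] {E : ℂ →+ X}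
    (hc : Continuous E) (h : 𝓝 (0 : X) ≤ map E (𝓝 0)) : IsQuotientMap E := by
  have hopen : IsOpenMap E := IsTopologicalAddGroup.isOpenMap_iff_nhds_zero.2 h
  refine hopen.isQuotientMap hc ?_
  have h1 : IsOpen (E.range : Set X) := by
    rw [AddMonoidHom.coe_range]
    exact hopen.isOpen_range
  have h2 : IsClopen (E.range : Set X) := ⟨AddSubgroup.isClosed_of_isOpen _ h1, h1⟩
  have h3 := h2.eq_univ ⟨0, E.range.zero_mem⟩
  rw [AddMonoidHom.coe_range] at h3
  exact Set.range_eq_univ.1 h3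

theorem isCoveringMap_of_isDiscrete_ker {E : ℂ →+ X} (hE : Topology.IsQuotientMap E)
    (h : IsDiscrete (E.ker : Set ℂ)) : IsCoveringMap E :=
  (hE.isAddQuotientCoveringMap_of_isDiscrete_ker_addMonoidHom h).isCoveringMap

end

open Filter Topology in
/-- Uniformization of a compact connected one-dimensional complex Lie group. -/
theorem exists_isUniformization (X : Type*) [AddCommGroup X] [TopologicalSpace X]
    [CompactSpace X] [ConnectedSpace X] [ChartedSpace ℂ X] [LieAddGroup 𝓘(ℂ) ω X] :
    ∃ E : ℂ →+ X, IsPeriodLattice E.ker ∧ IsUniformization E.ker E := by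
  have : IsTopologicalAddGroup X := topologicalAddGroup_of_lieAddGroup 𝓘(ℂ) ω
  obtain ⟨E, l, hEd, hl0, hld, hEl, hlE⟩ := exists_exp X
  have hlc : Tendsto l (𝓝 0) (𝓝 0) := by
    simpa [ContinuousAt, hl0] using hld.continuousAt
  have hquot : IsQuotientMap E := by
    refine isQuotientMap_of_nhds_le hEd.continuous fun s hs => ?_
    filter_upwards [hlc.eventually (mem_map.1 hs), hEl] with x hx hx2
    simpa [hx2] using hx
  have hdisc : IsDiscrete (E.ker : Set ℂ) := by
    refine isDiscrete_of_eventually_eq_zero ?_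
    filter_upwards [hlE] with z hz hzk
    rw [← hz, (AddMonoidHom.mem_ker).1 hzk, hl0]
  refine ⟨E, isPeriodLattice_of_isDiscrete hdisc (span_ker_eq_top hquot),
    ⟨isCoveringMap_of_isDiscrete_ker hquot hdisc, hEd, hquot.surjective, fun z w => ?_,
      fun f hf hEf z₀ => ?_⟩⟩
  · rw [AddMonoidHom.mem_ker, map_sub, sub_eq_zero]
  · have h1 : MDifferentiableAt 𝓘(ℂ) 𝓘(ℂ) (fun z => E (f z) + -E (f z₀)) z₀ :=
      MDifferentiableAt.comp z₀ (g := fun x => x + -E (f z₀))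
        ((contMDiff_add_right (I := 𝓘(ℂ)) (n := ω)).mdifferentiable (by simp) _) (hEf z₀)
    have h2 : MDifferentiableAt 𝓘(ℂ) 𝓘(ℂ) (fun z => l (E (f z) + -E (f z₀))) z₀ :=
      MDifferentiableAt.comp z₀ (g := l) (by rw [add_neg_cancel]; exact hld) h1
    rw [mdifferentiableAt_iff_differentiableAt] at h2
    have h3 : DifferentiableAt ℂ (fun z => l (E (f z) + -E (f z₀)) + f z₀) z₀ :=
      h2.add_const _
    -- Near `z₀`, continuity of `f` lets `l` recover `f z - f z₀` from `E (f z) - E (f z₀)`.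
    refine h3.congr_of_eventuallyEq ?_
    have h4 : Tendsto (fun z => f z - f z₀) (𝓝 z₀) (𝓝 0) := by
      have : Continuous fun z => f z - f z₀ := by fun_prop
      simpa using this.tendsto z₀
    filter_upwards [h4.eventually hlE] with z hz
    rw [← map_neg, ← map_add, ← sub_eq_add_neg, hz, sub_add_cancel]

/-! ### Uniformization of the quotients `X ⧸ C`. -/

section

variable {X : Type*} [AddCommGroup X] [TopologicalSpace X] [T2Space X] [ChartedSpace ℂ X]
  [LieAddGroup 𝓘(ℂ) ω X]

theorem exists_extChartAt_quotient_eq [IsTopologicalAddGroup X] (C : AddSubgroup X) [Finite C]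
    (q : X ⧸ C) : ∃ a : X, (a : X ⧸ C) = q ∧ ⇑(extChartAt 𝓘(ℂ) q) =
      extChartAt 𝓘(ℂ) a ∘ (isLocalHomeomorph_mk_of_finite C).localInverseAt a :=
  ⟨_, (QuotientAddGroup.mk_surjective (s := C)).hasRightInverse.choose_spec q, rfl⟩

open Filter Topology in
/-- A continuous map to `X` is holomorphic at a point if and only if its composition with the
projection `X → X ⧸ C` is. -/
theorem mdifferentiableAt_mk_comp_iff (C : AddSubgroup X) [Finite C] {h : ℂ → X} {z₀ : ℂ}
    (hh : ContinuousAt h z₀) :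
    MDifferentiableAt 𝓘(ℂ) 𝓘(ℂ) (fun z => (h z : X ⧸ C)) z₀ ↔
      MDifferentiableAt 𝓘(ℂ) 𝓘(ℂ) h z₀ := by
  have : IsTopologicalAddGroup X := topologicalAddGroup_of_lieAddGroup 𝓘(ℂ) ω
  have hf := isLocalHomeomorph_mk_of_finite C
  obtain ⟨a, ha, hchart⟩ := exists_extChartAt_quotient_eq C (h z₀ : X ⧸ C)
  -- The quotient chart uses a chosen preimage `a` of the point, which may differ from `h z₀`;
  -- translation by `c ∈ C` compensates.
  set c : X := a - h z₀ with hc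
  have hac : h z₀ + c = a := by rw [hc]; abel
  have hcC : c ∈ C := by
    rw [← QuotientAddGroup.eq_zero_iff, hc, QuotientAddGroup.mk_sub, ha, sub_self]
  have hmk : ContinuousAt (fun z => (h z : X ⧸ C)) z₀ :=
    hf.continuous.continuousAt.comp hh
  have hmkc : ContinuousAt (fun z => h z + c) z₀ := hh.add continuousAt_const
  have e1 : ∀ᶠ z in 𝓝 z₀, h z + c ∈ (hf.localInverseAt a).target :=
    hmkc.eventually_mem ((hf.localInverseAt a).open_target.mem_nhds (by
      rw [hac]; exact hf.self_mem_localInverseAt_target))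
  have e2 : ∀ᶠ z in 𝓝 z₀, (h z : X ⧸ C) ∈ (hf.localInverseAt a).source :=
    hmk.eventually_mem ((hf.localInverseAt a).open_source.mem_nhds (by
      rw [← ha]; exact hf.apply_self_mem_localInverseAt_source))
  have e3 : (extChartAt 𝓘(ℂ) (h z₀ : X ⧸ C) ∘ fun z => (h z : X ⧸ C)) =ᶠ[𝓝 z₀]
      extChartAt 𝓘(ℂ) a ∘ fun z => h z + c := by
    filter_upwards [e1, e2] with z hz1 hz2
    simp only [Function.comp, hchart]
    congr 1
    refine hf.injOn_localInverseAt_target ((hf.localInverseAt a).map_source hz2) hz1 ?_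
    rw [hf.apply_localInverseAt_of_mem hz2, QuotientAddGroup.mk_add,
      (QuotientAddGroup.eq_zero_iff c).2 hcC, add_zero]
  have e4 : MDifferentiableAt 𝓘(ℂ) 𝓘(ℂ) (fun z => h z + c) z₀ ↔
      MDifferentiableAt 𝓘(ℂ) 𝓘(ℂ) (extChartAt 𝓘(ℂ) a ∘ fun z => h z + c) z₀ := by
    rw [mdifferentiableAt_iff_target, hac]
    exact and_iff_right hmkc
  have hadd (b : X) : MDifferentiable 𝓘(ℂ) 𝓘(ℂ) (fun x : X => x + b) :=
    (contMDiff_add_right (I := 𝓘(ℂ)) (n := ω)).mdifferentiable (by simp)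
  have e5 : MDifferentiableAt 𝓘(ℂ) 𝓘(ℂ) (fun z => h z + c) z₀ ↔
      MDifferentiableAt 𝓘(ℂ) 𝓘(ℂ) h z₀ := by
    refine ⟨fun H => ?_, fun H => MDifferentiableAt.comp z₀ (hadd c _) H⟩
    have := MDifferentiableAt.comp z₀ (hadd (-c) _) H
    simpa [Function.comp_def] using this
  rw [mdifferentiableAt_iff_target, ← e5, e4]
  exact ⟨fun H => H.2.congr_of_eventuallyEq e3.symm,
    fun H => ⟨hmk, H.congr_of_eventuallyEq e3⟩⟩

open Filter Topology in
/-- A uniformization of `X` by a homomorphism induces a uniformization of `X ⧸ C`. -/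
theorem IsUniformization.quotient {E : ℂ →+ X} (h : IsUniformization E.ker E)
    (C : AddSubgroup X) [Finite C] :
    IsUniformization (C.comap E) (fun z => (E z : X ⧸ C)) := by
  have : IsTopologicalAddGroup X := topologicalAddGroup_of_lieAddGroup 𝓘(ℂ) ω
  set E' : ℂ →+ X ⧸ C := (QuotientAddGroup.mk' C).comp E with hE'
  have hquot : IsQuotientMap E' :=
    (QuotientAddGroup.isQuotientMap_mk C).comp
      (h.isCoveringMap.isQuotientMap h.surjective)
  have hker : E'.ker = C.comap E := by
    ext z
    simp [hE', AddMonoidHom.mem_ker]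
  have hC : ∀ᶠ x in 𝓝 (0 : X), x ∈ C → x = 0 := by
    have hfin : ((C : Set X) \ {0}).Finite := (Set.toFinite (C : Set X)).subset Set.sdiff_subset
    have : ((C : Set X) \ {0})ᶜ ∈ 𝓝 (0 : X) := hfin.isClosed.isOpen_compl.mem_nhds (by simp)
    filter_upwards [this] with x hx hxC
    by_contra h0
    exact hx ⟨hxC, h0⟩
  have hcont : Tendsto E (𝓝 0) (𝓝 0) := by
    simpa using h.holomorphic.continuous.tendsto 0
  -- Near `0` the finite group `C` meets the image of `E` only at `0`, and `E` is injective there.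
  have hdisc : IsDiscrete (E'.ker : Set ℂ) := by
    obtain ⟨U, hU, h0U, hinj⟩ := h.isCoveringMap.isLocalHomeomorph.isLocallyInjective 0
    refine isDiscrete_of_eventually_eq_zero ?_
    filter_upwards [hcont.eventually hC, hU.mem_nhds h0U] with z hz hzU hzk
    rw [hker] at hzk
    exact hinj hzU h0U ((hz hzk).trans (map_zero E).symm)
  refine ⟨isCoveringMap_of_isDiscrete_ker hquot hdisc, fun z => ?_, hquot.surjective,
    fun z w => ?_, fun f hf hEf => ?_⟩
  · exact (mdifferentiableAt_mk_comp_iff C h.holomorphic.continuous.continuousAt).2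
      (h.holomorphic z)
  · rw [AddSubgroup.mem_comap, map_sub, ← QuotientAddGroup.eq_zero_iff, QuotientAddGroup.mk_sub,
      sub_eq_zero]
  · refine h.differentiable_of_comp f hf fun z => ?_
    exact (mdifferentiableAt_mk_comp_iff C
      (h.holomorphic.continuous.comp hf).continuousAt).1 (hEf z)

end

/-! ### Cyclic subgroups as cyclic overlattices, and the conclusion. -/

theorem comap_mem_cyclicOver {X : Type*} [AddCommGroup X] {E : ℂ →+ X}
    (hE : Function.Surjective E) {N : ℕ} (C : CyclicSubgroups X N) :
    C.1.comap E ∈ cyclicOver N E.ker := by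
  obtain ⟨C, hcyc, hcard⟩ := C
  obtain ⟨g, rfl⟩ := (AddSubgroup.isAddCyclic_iff_exists_zmultiples_eq_top C).1 hcyc
  obtain ⟨w, rfl⟩ := hE g
  rw [Nat.card_zmultiples] at hcard
  refine ⟨w, ?_, fun n => ?_⟩
  · simp only
    rw [← AddMonoidHom.map_zmultiples, AddSubgroup.comap_map_eq, sup_comm]
  · rw [← zsmul_eq_mul, AddMonoidHom.mem_ker, map_zsmul, ← addOrderOf_dvd_iff_zsmul_eq_zero, hcard]

theorem range_comap_cyclicSubgroups {X : Type*} [AddCommGroup X] {E : ℂ →+ X}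
    (hE : Function.Surjective E) (N : ℕ) :
    Set.range (fun C : CyclicSubgroups X N => C.1.comap E) = cyclicOver N E.ker := by
  refine Set.Subset.antisymm (Set.range_subset_iff.2 (comap_mem_cyclicOver hE)) ?_
  rintro _ ⟨w, rfl, hw⟩
  refine ⟨⟨AddSubgroup.zmultiples (E w), inferInstance, ?_⟩, ?_⟩
  · rw [Nat.card_zmultiples]
    have h (n : ℤ) : (addOrderOf (E w) : ℤ) ∣ n ↔ (N : ℤ) ∣ n := by
      rw [← hw, ← zsmul_eq_mul, AddMonoidHom.mem_ker, map_zsmul, addOrderOf_dvd_iff_zsmul_eq_zero]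
    exact Nat.dvd_antisymm (by exact_mod_cast (h N).2 dvd_rfl)
      (by exact_mod_cast (h (addOrderOf (E w))).1 dvd_rfl)
  · simp only
    rw [← AddMonoidHom.map_zmultiples, AddSubgroup.comap_map_eq, sup_comm]

/-- `X` is a compact connected Riemann surface with a holomorphic group law, that is, a Riemann
surface of genus `1` with a chosen origin. -/
theorem mainTheorem6 {X : Type*} [AddCommGroup X] [TopologicalSpace X] [T2Space X]
    [CompactSpace X] [ConnectedSpace X] [ChartedSpace ℂ X] [LieAddGroup 𝓘(ℂ) ω X]
    (N : ℕ) [NeZero N] :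
    Finite (CyclicSubgroups X N) ∧ (Nat.card (CyclicSubgroups X N) : ℝ) = eN N ∧
      1 / eN N * ∑ᶠ C : CyclicSubgroups X N,
          (1 / 12 * Real.log (normDelta X) - 1 / 12 * Real.log (normDelta (X ⧸ C.1))) =
        1 / 2 * Real.log N - lambdaN N := by
  obtain ⟨E, hL, hE⟩ := exists_isUniformization X
  have hN : 0 < N := Nat.pos_of_neZero N
  obtain ⟨hfin, hcard⟩ := cyclicOver_finite hN hL
  have hlog := finsum_log_latticeDelta hN hL
  have hinj : Function.Injective (fun C : CyclicSubgroups X N => C.1.comap E) := fun C D h =>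
    Subtype.ext (AddSubgroup.comap_injective hE.surjective h)
  have hrange := range_comap_cyclicSubgroups hE.surjective N
  have hF : Finite (CyclicSubgroups X N) := by
    rw [← hrange] at hfin
    exact (Set.finite_range_iff hinj).1 hfin
  -- Preimage under `E` is a bijection onto the cyclic overlattices of the kernel, so sums transfer.
  have hsum (f : AddSubgroup ℂ → ℝ) : ∑ᶠ C : CyclicSubgroups X N, f (C.1.comap E) =
      ∑ᶠ L' ∈ cyclicOver N E.ker, f L' := by
    rw [← hrange, finsum_mem_range hinj]
  refine ⟨hF, ?_, ?_⟩
  · rw [← hcard, ← hsum fun _ => 1]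
    have := Fintype.ofFinite (CyclicSubgroups X N)
    simp [finsum_eq_sum_of_fintype, Nat.card_eq_fintype_card]
  · have hterm (C : CyclicSubgroups X N) : normDelta (X ⧸ C.1) = latticeDelta (C.1.comap E) :=
      (hE.quotient C.1).normDelta_eq (hL.of_mem_cyclicOver hN (comap_mem_cyclicOver hE.surjective C))
    simp only [hterm, hE.normDelta_eq hL]
    rw [hsum fun L' => 1 / 12 * Real.log (latticeDelta E.ker) - 1 / 12 * Real.log (latticeDelta L'),
      finsum_mem_sub_distrib _ _ hfin]
    have h1 : ∑ᶠ _L' ∈ cyclicOver N E.ker, 1 / 12 * Real.log (latticeDelta E.ker) =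
        1 / 12 * Real.log (latticeDelta E.ker) * eN N := by
      rw [← hcard, mul_finsum_mem]
      simp only [mul_one]
    have h2 := (eN_pos hN).ne'
    rw [h1, ← mul_finsum_mem, hlog, heckeConst]
    field_simp
    ring
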